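/- Let $N$ be a finite non-empty set of players, $S_i$ a finite action set for each $i\in N$, and $u_i(G,\mathbf s)$ player $i$'s payoff at the outcome $(G,\mathbf s)$, where $G$ is a simple undirected graph on $N$ and $\mathbf s\in\prod_i S_i$. Assume that payoffs are generic: given $G$ and $\mathbf s_{-i}$, every player $i$ has a unique payoff-maximizing action, and $u_i(G+ij,\mathbf s)\neq u_i(G,\mathbf s)$ whenever $i\ne j$ and $ij\notin G$. An outcome $(G,\mathbf s)$ is \emph{pairwise stable} if (a) $\mathbf s$ is a Nash equilibrium of the game in which $G$ is fixed; (b) there is no link $ij\in G$ with $u_i(G-ij,\mathbf s)>u_i(G,\mathbf s)$; (c) there is no link $ij\notin G$ with $u_i(G+ij,\mathbf s)\ge u_i(G,\mathbf s)$ and $u_j(G+ij,\mathbf s)\ge u_j(G,\mathbf s)$, at least one of the two inequalities being strict. In the \emph{revision game}, time $t\ge 0$ is continuous and play starts from an initial outcome $(G^{(0)},\mathbf s^{(0)})$. Each player $i$ and each ordered pair $ij$ of distinct players has an independent Poisson clock of rate $\lambda>0$. When the clock of $i$ rings, $i$ may change her action $s_i$. When the clock of $ij$ rings, $i$ may delete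 the link $ij$ if it exists, and may propose it to $j$ if it does not; $j$ accepts or rejects at that instant, and the link is added if $j$ accepts. Past rings and moves are observed by all players, and strategies (which may be randomized) may depend on the whole history. Players receive the flow payoff $u_i(G^{(t)},\mathbf s^{(t)})$, discounted with a common factor $\delta\in(0,1)$, that is, the total payoff is $\int_0^\infty \delta^t u_i(G^{(t)},\mathbf s^{(t)})\,dt$, and they maximize its expectation. Fix any $\delta\in(0,1)$. There is $\lambda_0>0$ (depending only on the payoffs and on $\delta$) such that for all $\lambda\in(0,\lambda_0)$ the following statements hold. 1. If, for some initial outcome, there exist a subgame perfect Nash equilibrium of the revision game and an almost surely finite stopping time $\tau$ such that, almost surely, $(G,\mathbf s)$ is played on the path of this equilibrium at all $t\ge\tau$, then $(G,\mathbf s)$ is pairwise stable. 2. Conversely, if $(G,\mathbf s)$ is pairwise stable, then there exists a subgame perfect Nash equilibrium (in pure strategies) of the revision game with initial outcome $(G^{(0)},\mathbf s^{(0)})=(G,\mathbf s)$ in which, almost surely, $(G,\mathbf s)$ is played at all times $t\ge 0$. -/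

import Mathlib

open MeasureTheory ProbabilityTheory

noncomputable section

universe v w

/-- An outcome of a network game with network formation: a simple undirected graph on the players
together with a profile of actions. -/
abbrev Outcome (N : Type v) (S : N → Type w) := SimpleGraph N × (∀ i, S i)

namespace Outcome

variable {N : Type v} {S : N → Type w}

/-- The outcome in which player `i` plays `a` and nothing else is changed. -/
def setAction [DecidableEq N] (x : Outcome N S) (i : N) (a : S i) : Outcome N S :=
  (x.1, Function.update x.2 i a)

/-- The outcome `(G + ij, s)`. -/
def addLink (x : Outcome N S) (i j : N) : Outcome N S :=
  (x.1 ⊔ SimpleGraph.edge i j, x.2)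

/-- The outcome `(G - ij, s)`. -/
def deleteLink (x : Outcome N S) (i j : N) : Outcome N S :=
  (x.1 \ SimpleGraph.edge i j, x.2)

end Outcome

/-- Pairwise stability: actions form a Nash equilibrium on the given graph, nobody strictly gains
from deleting a link, and no missing link makes both of its ends weakly better off, one of them
strictly. -/
def PairwiseStable {N : Type v} {S : N → Type w} [DecidableEq N]
    (u : N → Outcome N S → ℝ) (x : Outcome N S) : Prop :=
  (∀ (i : N) (a : S i), u i (x.setAction i a) ≤ u i x) ∧
  (∀ i j : N, x.1.Adj i j → ¬ u i x < u i (x.deleteLink i j)) ∧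
  (∀ i j : N, i ≠ j → ¬ x.1.Adj i j →
    ¬ (u i x ≤ u i (x.addLink i j) ∧ u j x ≤ u j (x.addLink i j) ∧
        (u i x < u i (x.addLink i j) ∨ u j x < u j (x.addLink i j))))

/-- Generic payoffs: every player has a unique myopically optimal action, given the graph and the
actions of the others, and no player is indifferent about one of her links. -/
def GenericPayoffs {N : Type v} {S : N → Type w} [DecidableEq N]
    (u : N → Outcome N S → ℝ) : Prop :=
  (∀ (i : N) (x : Outcome N S),
    ∃! a : S i, ∀ b : S i, u i (x.setAction i b) ≤ u i (x.setAction i a)) ∧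
  (∀ (i j : N) (x : Outcome N S), i ≠ j → ¬ x.1.Adj i j → u i (x.addLink i j) ≠ u i x)

/-- The clocks: one for each player (revision of her action) and one for each ordered pair of
distinct players (revision of the link between them by the first one). -/
abbrev Clock (N : Type v) := N ⊕ {p : N × N // p.1 ≠ p.2}

/-- What may happen when a clock rings. -/
inductive Move (N : Type v) (S : N → Type w) : Type (max v w)
  /-- Player `i`, whose action clock has rung, plays `a` from now on. -/
  | setAction (i : N) (a : S i)
  /-- The clock `ij` has rung, and `i` neither deletes nor proposes the link. -/
  | pass (i j : N)
  /-- The clock `ij` has rung, and `i` deletes the existing link. -/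
  | delete (i j : N)
  /-- The clock `ij` has rung, `i` proposes the missing link, and `j` accepts. -/
  | accepted (i j : N)
  /-- The clock `ij` has rung, `i` proposes the missing link, and `j` rejects. -/
  | rejected (i j : N)

namespace Move

variable {N : Type v} {S : N → Type w}

/-- The outcome after a move. -/
def apply [DecidableEq N] (x : Outcome N S) : Move N S → Outcome N S
  | setAction i a => x.setAction i a
  | pass _ _ => x
  | delete i j => x.deleteLink i j
  | accepted i j => x.addLink i j
  | rejected _ _ => x

/-- The moves that are possible at an outcome. -/
def Legal (x : Outcome N S) : Move N S → Prop
  | setAction _ _ => True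
  | pass i j => i ≠ j
  | delete i j => x.1.Adj i j
  | accepted i j => i ≠ j ∧ ¬ x.1.Adj i j
  | rejected i j => i ≠ j ∧ ¬ x.1.Adj i j

end Move

/-- A history: the times of the past rings and the moves made at them, most recent first. -/
abbrev History (N : Type v) (S : N → Type w) := List (ℝ × Move N S)

/-- The time of the last ring in a history (`0` if there was none). -/
def History.lastTime {N : Type v} {S : N → Type w} : History N S → ℝ
  | [] => 0
  | e :: _ => e.1

/-- A decision rule with values in `D` is measurable if, whatever the number of past rings and the
moves made at them, it is a jointly measurable function of the times of these rings, the current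
time and the random draw. -/
def MeasurableRule {N : Type v} {S : N → Type w} {D : Type*}
    (f : History N S → ℝ → unitInterval → D) : Prop :=
  ∀ (n : ℕ) (m : Fin n → Move N S),
    @Measurable _ D _ ⊤ (fun p : (Fin n → ℝ) × ℝ × unitInterval =>
      f (List.ofFn fun k => (p.1 k, m k)) p.2.1 p.2.2)

/-- A (behaviour) strategy of player `i`. Each decision may depend on the whole history, on the
current time, and on a fresh uniform draw from `[0, 1]`, through which the player may randomize. -/
structure Strategy (N : Type v) (S : N → Type w) (i : N) where
  /-- The action taken when the action clock of `i` rings. -/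
  act : History N S → ℝ → unitInterval → S i
  /-- When the clock `ij` rings: whether `i` deletes the link, if it exists, and whether she
  proposes it, if it does not. -/
  link : N → History N S → ℝ → unitInterval → Bool
  /-- When `i` receives a proposal from `j`: whether she accepts. -/
  respond : N → History N S → ℝ → unitInterval → Bool
  measurable_act : MeasurableRule act
  measurable_link : ∀ j, MeasurableRule (link j)
  measurable_respond : ∀ j, MeasurableRule (respond j)

/-- A strategy is pure if it never uses the random draws. -/
def Strategy.IsPure {N : Type v} {S : N → Type w} {i : N} (σ : Strategy N S i) : Prop :=
  ∀ (h : History N S) (t : ℝ) (r r' : unitInterval),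
    σ.act h t r = σ.act h t r' ∧
    (∀ j, σ.link j h t r = σ.link j h t r') ∧
    (∀ j, σ.respond j h t r = σ.respond j h t r')

/-- A strategy profile. -/
abbrev Profile (N : Type v) (S : N → Type w) := ∀ i, Strategy N S i

/-- The sample space. The first component gives the waiting times of each clock: the wait until its
first ring, then the waits between its successive rings. The second gives, for each ring of any
clock in chronological order, the random draw used by the player whose clock rings and the one used
by the player who answers a proposal. -/
abbrev Sample (N : Type v) := (Clock N → ℕ → ℝ) × (ℕ → unitInterval × unitInterval)

/-- The law of independent Poisson clocks of rate `rate` (for each clock, the waiting times are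
independent and exponential with parameter `rate`) and of independent uniform random draws. -/
def sampleLaw (N : Type v) [Fintype N] [DecidableEq N] (rate : ℝ) : Measure (Sample N) :=
  (Measure.pi fun _ : Clock N => Measure.infinitePi fun _ : ℕ => expMeasure rate).prod
    (Measure.infinitePi fun _ : ℕ => (volume : Measure (unitInterval × unitInterval)))

section Clocks

variable {N : Type v}

/-- The clock that rings next, given the remaining waiting times of all clocks. -/
def nextClock [Nonempty N] (W : Clock N → ℕ → ℝ) : Clock N :=
  Classical.epsilon fun c => ∀ d, W c 0 ≤ W d 0

/-- The remaining waiting times of all clocks just after the next ring. -/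
def advance [Nonempty N] [DecidableEq N] (W : Clock N → ℕ → ℝ) : Clock N → ℕ → ℝ := fun c =>
  if c = nextClock W then fun k => W c (k + 1)
  else Function.update (W c) 0 (W c 0 - W (nextClock W) 0)

end Clocks

/-- A situation in the course of play: the history so far, the current time, and the part of the
sample that is still to be used. -/
structure Situation (N : Type v) (S : N → Type w) where
  history : History N S
  time : ℝ
  waits : Clock N → ℕ → ℝ
  draws : ℕ → unitInterval × unitInterval

/-- The points at which a subgame begins. -/
inductive Node (N : Type v) (S : N → Type w) : Type (max v w)
  /-- At time `t`, after the history `h`, all players wait for the next ring. -/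
  | waiting (h : History N S) (t : ℝ)
  /-- At time `t`, after the history `h`, the clock `c` rings. -/
  | ring (h : History N S) (t : ℝ) (c : Clock N)
  /-- At time `t`, after the history `h`, the clock `ij` has rung, and `i` has proposed the missing
  link to `j`, who is to answer. -/
  | proposal (h : History N S) (t : ℝ) (i j : N)

/-- The time at which a subgame begins. -/
def Node.time {N : Type v} {S : N → Type w} : Node N S → ℝ
  | waiting _ t => t
  | ring _ t _ => t
  | proposal _ t _ _ => t

/-- The data of a revision game: flow payoffs, the common discount factor, the rate of the Poisson
clocks and the initial condition. -/
structure RevisionGame (N : Type v) (S : N → Type w) where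
  payoff : N → Outcome N S → ℝ
  discount : ℝ
  discount_pos : 0 < discount
  discount_lt_one : discount < 1
  rate : ℝ
  rate_pos : 0 < rate
  initial : Outcome N S

namespace RevisionGame

variable {N : Type v} {S : N → Type w} [DecidableEq N] (Γ : RevisionGame N S)

/-- The current outcome after a history. -/
def state : History N S → Outcome N S
  | [] => Γ.initial
  | e :: h => e.2.apply (state h)

/-- The histories that can occur: the rings are at distinct positive times and the moves are
possible. -/
def Feasible : History N S → Prop
  | [] => True
  | e :: h => Feasible h ∧ History.lastTime h < e.1 ∧ e.2.Legal (Γ.state h)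

/-- The nodes that can occur. -/
def IsNode : Node N S → Prop
  | .waiting h t => Γ.Feasible h ∧ History.lastTime h ≤ t
  | .ring h t _ => Γ.Feasible h ∧ History.lastTime h < t
  | .proposal h t i j =>
      Γ.Feasible h ∧ History.lastTime h < t ∧ i ≠ j ∧ ¬ (Γ.state h).1.Adj i j

/-- The answer of `j` to the proposal of `i` and its consequence, if the draw of `j` is `r`. -/
def answer (σ : Profile N S) (h : History N S) (t : ℝ) (i j : N) (r : unitInterval) : Move N S :=
  if (σ j).respond i h t r then .accepted i j else .rejected i j

open Classical in
/-- The move made when the clock `c` rings at time `t` after the history `h`, if the draws of the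
owner of the clock and of the player who may have to answer are `r.1` and `r.2`. -/
def move (σ : Profile N S) (h : History N S) (t : ℝ) (c : Clock N)
    (r : unitInterval × unitInterval) : Move N S :=
  match c with
  | .inl i => .setAction i ((σ i).act h t r.1)
  | .inr ⟨(i, j), _⟩ =>
      if (σ i).link j h t r.1 then
        if (Γ.state h).1.Adj i j then .delete i j else answer σ h t i j r.2
      else .pass i j

variable [Nonempty N]

/-- Play from one situation until just after the next ring. -/
def step (σ : Profile N S) (p : Situation N S) : Situation N S :=
  let c := nextClock p.waits
  let t := p.time + p.waits c 0
  { history := (t, Γ.move σ p.history t c (p.draws 0)) :: p.history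
    time := t
    waits := advance p.waits
    draws := fun k => p.draws (k + 1) }

/-- The situation just after the `n`-th ring from the situation `p` on. -/
def play (σ : Profile N S) (p : Situation N S) (n : ℕ) : Situation N S :=
  (Γ.step σ)^[n] p

open Classical in
/-- The outcome that is in force at time `t` when the profile `σ` is played from the situation `p`
on. Almost surely, there are finitely many rings up to time `t`. -/
def outcomeAt (σ : Profile N S) (p : Situation N S) (t : ℝ) : Outcome N S :=
  if H : ∃ n, t < (Γ.play σ p (n + 1)).time then Γ.state (Γ.play σ p (Nat.find H)).history
  else Γ.state p.history

/-- The situation at the beginning of a subgame, after the decision, if any, that is pending at its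
first node has been taken. As Poisson clocks are memoryless, the waiting times from this date on
are those of fresh clocks. -/
def start (σ : Profile N S) (ω : Sample N) : Node N S → Situation N S
  | .waiting h t => ⟨h, t, ω.1, ω.2⟩
  | .ring h t c => ⟨(t, Γ.move σ h t c (ω.2 0)) :: h, t, ω.1, fun k => ω.2 (k + 1)⟩
  | .proposal h t i j =>
      ⟨(t, answer σ h t i j (ω.2 0).2) :: h, t, ω.1, fun k => ω.2 (k + 1)⟩

/-- The outcome in force at time `t` on the path of `σ` in the whole game. -/
def onPath (σ : Profile N S) (ω : Sample N) (t : ℝ) : Outcome N S :=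
  Γ.outcomeAt σ (Γ.start σ ω (.waiting [] 0)) t

variable [Fintype N]

/-- The expected discounted payoff of player `i` in the subgame that begins at `ν`. -/
def value (σ : Profile N S) (ν : Node N S) (i : N) : ℝ :=
  ∫ ω, (∫ t in Set.Ioi ν.time,
    Γ.discount ^ (t - ν.time) * Γ.payoff i (Γ.outcomeAt σ (Γ.start σ ω ν) t)) ∂(sampleLaw N Γ.rate)

/-- Subgame perfect Nash equilibrium: in no subgame can a player gain by changing her strategy. -/
def IsSPNE (σ : Profile N S) : Prop :=
  ∀ ν : Node N S, Γ.IsNode ν → ∀ (i : N) (ρ : Strategy N S i),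
    Γ.value (Function.update σ i ρ) ν i ≤ Γ.value σ ν i

end RevisionGame

end

/-! When clocks are slow compared with the discount rate `r = -log δ`, the flow payoff until the
next ring dominates everything that comes later. Let `M` bound all payoffs and let `Δ` bound from
below the gap between any two different payoffs of one player. If two courses of play agree up to a
ring and then differ by at least `Δ` in flow payoff until the next ring, a time `w` later, the
discounted loss is at least a positive multiple of `Δ - (Δ + 2 * M) * exp (-r * w)`, whatever
happens afterwards (`discounted_sub_le`, `pathValue_sub_le`). The expectation of `exp (-r * w)` is
at most the number of clocks times `λ / r` (`integral_exp_wait_le`), so for small `λ` the expected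
loss is positive. Equilibrium behaviour is therefore myopic wherever myopic incentives are strict,
and genericity makes them strict.

Statement 1. In an equilibrium, a decision that costs `Δ` until the next ring has probability zero
at every node: otherwise one would correct that single decision (`IsSPNE.volume_eq_zero`). At an
outcome that is not pairwise stable there is a clock, depending on the outcome only, whose ring
almost surely changes the outcome (`exists_clock_leaving`). That clock almost surely rings after any
given date (`exists_nextClock_eq`), so the outcome cannot persist.

Statement 2. In the profile where everybody maximizes her flow payoff until the next ring, behaviour
depends on the current outcome only. Hence a unilateral deviation is harmless to the deviator until
it first changes the outcome, and at that moment she loses at least `Δ` until the next ring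
(`payoff_lt_of_first_deviation`). Summing over the index of this first change gives the equilibrium
property. The waiting time after `n` rings must be independent of the past; this renewal property
comes from the memorylessness of the exponential law (`map_nextRing_advance`,
`exists_map_pastRings_advance`). At a pairwise stable outcome the myopic profile changes nothing
(`onPath_myopicProfile`). -/

noncomputable section

/-! ### Splitting one coordinate off a product measure -/

/-- The sequence with first term `a` and remaining terms `V`. -/
def consSeq {X : Type*} (a : X) (V : ℕ → X) : ℕ → X
  | 0 => a
  | n + 1 => V n

@[simp] lemma consSeq_zero {X : Type*} (a : X) (V : ℕ → X) : consSeq a V 0 = a := rfl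

@[simp] lemma consSeq_succ {X : Type*} (a : X) (V : ℕ → X) (n : ℕ) :
    consSeq a V (n + 1) = V n := rfl

@[fun_prop] lemma measurable_consSeq {X : Type*} [MeasurableSpace X] :
    Measurable fun p : X × (ℕ → X) => consSeq p.1 p.2 := by
  refine measurable_pi_lambda _ fun n => ?_
  cases n with
  | zero => exact measurable_fst
  | succ n => exact (measurable_pi_apply n).comp measurable_snd

/-- Allows conditioning on all but the first term of an i.i.d. sequence, so that statements about
one waiting time extend to the whole sequence of a clock. -/
lemma measurePreserving_consSeq {X : Type*} [MeasurableSpace X] (μ : Measure X)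
    [IsProbabilityMeasure μ] :
    MeasurePreserving (fun p : X × (ℕ → X) => consSeq p.1 p.2)
      (μ.prod (Measure.infinitePi fun _ : ℕ => μ)) (Measure.infinitePi fun _ : ℕ => μ) := by
  refine ⟨measurable_consSeq, Measure.eq_infinitePi _ fun s t ht => ?_⟩
  have hsub : s ⊆ Finset.range (s.sup id + 1) := fun k hk =>
    Finset.mem_range.2 (Nat.lt_succ_of_le (Finset.le_sup (f := id) hk))
  classical
  -- Unconstrained coordinates get the full set, so that the finite set `s` may be replaced by an
  -- initial segment of `ℕ` and the shift of indices becomes harmless.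
  set t' : ℕ → Set X := fun k => if k ∈ s then t k else Set.univ with ht'
  have ht'm : ∀ k, MeasurableSet (t' k) := fun k => by
    by_cases h : k ∈ s <;> simp [t', h, ht]
  rw [Measure.map_apply measurable_consSeq
    (MeasurableSet.pi s.countable_toSet fun k hk => ht k)]
  have hpre : (fun p : X × (ℕ → X) => consSeq p.1 p.2) ⁻¹' (Set.pi s t) =
      t' 0 ×ˢ Set.pi (Finset.range (s.sup id)) fun k => t' (k + 1) := by
    ext ⟨a, V⟩
    simp only [Set.mem_preimage, Set.mem_pi, Set.mem_prod, Finset.mem_coe]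
    constructor
    · intro h
      refine ⟨?_, fun k _ => ?_⟩
      · by_cases h0 : 0 ∈ s
        · simpa [t', h0] using h 0 h0
        · simp [t', h0]
      · by_cases h0 : k + 1 ∈ s
        · simpa [t', h0] using h _ h0
        · simp [t', h0]
    · rintro ⟨h0, h1⟩ k hk
      cases k with
      | zero => simpa [t', hk] using h0
      | succ k =>
        have := Finset.mem_range.1 (hsub hk)
        simpa [t', hk] using h1 k (Finset.mem_range.2 (by omega))
  rw [hpre, Measure.prod_prod, Measure.infinitePi_pi _ (fun k _ => ht'm _),
    mul_comm, ← Finset.prod_range_succ' (fun k => μ (t' k)), ← Finset.prod_subset hsub]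
  · exact Finset.prod_congr rfl fun k hk => by simp [t', hk]
  · intro k _ hk
    simp [t', hk]

/-- Allows conditioning on the row of one clock `c`. The entry `c` of the second component is
overwritten; keeping it avoids a product over the complement of `c`. -/
lemma measurePreserving_update_pi {C : Type*} [Fintype C] [DecidableEq C] {X : Type*}
    [MeasurableSpace X] (ν : Measure X) [IsProbabilityMeasure ν] (c : C) :
    MeasurePreserving (fun p : X × (C → X) => Function.update p.2 c p.1)
      (ν.prod (Measure.pi fun _ : C => ν)) (Measure.pi fun _ : C => ν) := by
  have hm : Measurable fun p : X × (C → X) => Function.update p.2 c p.1 := by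
    refine measurable_pi_lambda _ fun d => ?_
    by_cases h : d = c
    · subst h; simpa using measurable_fst
    · simp only [Function.update_of_ne h]; fun_prop
  refine ⟨hm, (Measure.pi_eq fun s hs => ?_).symm⟩
  rw [Measure.map_apply hm (MeasurableSet.univ_pi hs)]
  have hpre : (fun p : X × (C → X) => Function.update p.2 c p.1) ⁻¹' (Set.pi Set.univ s) =
      s c ×ˢ Set.pi Set.univ (Function.update s c Set.univ) := by
    ext ⟨a, V⟩
    simp only [Set.mem_preimage, Set.mem_pi, Set.mem_prod, Set.mem_univ, true_implies]
    constructor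
    · intro h
      refine ⟨by simpa using h c, fun d => ?_⟩
      by_cases hd : d = c
      · subst hd; simp
      · simpa [hd] using h d
    · rintro ⟨h0, h1⟩ d
      by_cases hd : d = c
      · subst hd; simpa using h0
      · simpa [hd] using h1 d
  rw [hpre, Measure.prod_prod, Measure.pi_pi, ← Finset.mul_prod_erase _ _ (Finset.mem_univ c),
    ← Finset.mul_prod_erase _ (fun i => ν (s i)) (Finset.mem_univ c)]
  simp only [Function.update_self, measure_univ, one_mul]
  congr 1
  exact Finset.prod_congr rfl fun d hd => by rw [Function.update_of_ne (Finset.ne_of_mem_erase hd)]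

/-! ### Exponential waiting times and memorylessness -/

section Exponential

variable {lam : ℝ}

lemma expMeasure_Iic (hl : 0 < lam) (x : ℝ) :
    expMeasure lam (Set.Iic x) = ENNReal.ofReal (if 0 ≤ x then 1 - Real.exp (-(lam * x)) else 0) := by
  have := isProbabilityMeasure_expMeasure hl
  rw [← cdf_expMeasure_eq hl, ofReal_cdf]

instance nullSingletonClass_expMeasure : NullSingletonClass (expMeasure lam) := by
  unfold expMeasure gammaMeasure; infer_instance

lemma expMeasure_Ioi (hl : 0 < lam) {x : ℝ} (hx : 0 ≤ x) :
    expMeasure lam (Set.Ioi x) = ENNReal.ofReal (Real.exp (-(lam * x))) := by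
  have := isProbabilityMeasure_expMeasure hl
  rw [← Set.compl_Iic, prob_compl_eq_one_sub measurableSet_Iic, expMeasure_Iic hl, if_pos hx,
    ← ENNReal.ofReal_one, ← ENNReal.ofReal_sub]
  · congr 1; ring
  · have : Real.exp (-(lam * x)) ≤ 1 := Real.exp_le_one_iff.2 (by nlinarith)
    linarith

lemma ae_pos_expMeasure (hl : 0 < lam) : ∀ᵐ x ∂(expMeasure lam), 0 < x := by
  rw [ae_iff]
  have : {a : ℝ | ¬ 0 < a} = Set.Iic 0 := by ext; simp
  rw [this, expMeasure_Iic hl]; simp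

/-- The exponential distribution is memoryless. -/
lemma expMeasure_memoryless (hl : 0 < lam) {t : ℝ} (ht : 0 ≤ t) :
    ((expMeasure lam).restrict (Set.Ioi t)).map (fun a => a - t) =
      ENNReal.ofReal (Real.exp (-(lam * t))) • expMeasure lam := by
  have := isProbabilityMeasure_expMeasure hl
  have : IsFiniteMeasure (((expMeasure lam).restrict (Set.Ioi t)).map (fun a => a - t)) :=
    Measure.isFiniteMeasure_map _ _
  refine Measure.ext_of_Iic _ _ fun x => ?_
  rw [Measure.map_apply (by fun_prop) measurableSet_Iic, Measure.restrict_apply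
    ((by fun_prop : Measurable fun a : ℝ => a - t) measurableSet_Iic), Measure.smul_apply,
    expMeasure_Iic hl, smul_eq_mul]
  have hpre : (fun a : ℝ => a - t) ⁻¹' Set.Iic x ∩ Set.Ioi t = Set.Iic (t + x) \ Set.Iic t := by
    ext a; simp only [Set.mem_inter_iff, Set.mem_preimage, Set.mem_Iic, Set.mem_Ioi, Set.mem_sdiff,
      not_le]; constructor <;> rintro ⟨h1, h2⟩ <;> exact ⟨by linarith, h2⟩
  rw [hpre]
  split_ifs with hx
  · rw [measure_sdiff (Set.Iic_subset_Iic.2 (by linarith)) measurableSet_Iic.nullMeasurableSet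
      (measure_ne_top _ _), expMeasure_Iic hl, expMeasure_Iic hl, if_pos ht, if_pos (by linarith),
      ← ENNReal.ofReal_sub, ← ENNReal.ofReal_mul (Real.exp_pos _).le]
    · congr 1
      rw [mul_sub, ← Real.exp_add]; ring_nf
    · have : Real.exp (-(lam * t)) ≤ 1 := Real.exp_le_one_iff.2 (by nlinarith)
      linarith
  · rw [Set.sdiff_eq_empty.2 (Set.Iic_subset_Iic.2 (by linarith))]; simp

/-- The law of the waiting times of one clock. -/
abbrev waitLaw (lam : ℝ) : Measure (ℕ → ℝ) := Measure.infinitePi fun _ : ℕ => expMeasure lam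

lemma measurable_update_zero_sub :
    Measurable fun p : ℝ × (ℕ → ℝ) => Function.update p.2 0 (p.2 0 - p.1) := by
  refine measurable_pi_lambda _ fun d => ?_
  by_cases h : d = 0
  · subst h; simp only [Function.update_self]; fun_prop
  · simp only [Function.update_of_ne h]; fun_prop

/-- Only the first waiting time is affected, so the memorylessness of one exponential variable is
applied on each slice where the later waiting times are fixed. -/
lemma waitLaw_memoryless (hl : 0 < lam) {t : ℝ} (ht : 0 ≤ t) {B : Set (ℕ → ℝ)}
    (hB : MeasurableSet B) :
    waitLaw lam {V | t < V 0 ∧ Function.update V 0 (V 0 - t) ∈ B} =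
      ENNReal.ofReal (Real.exp (-(lam * t))) * waitLaw lam B := by
  have := isProbabilityMeasure_expMeasure hl
  have hc := measurePreserving_consSeq (expMeasure lam)
  have hm : Measurable fun V : ℕ → ℝ => Function.update V 0 (V 0 - t) :=
    measurable_update_zero_sub.comp (measurable_const.prodMk measurable_id)
  have hS : MeasurableSet {V : ℕ → ℝ | t < V 0 ∧ Function.update V 0 (V 0 - t) ∈ B} :=
    (measurableSet_lt measurable_const (measurable_pi_apply 0)).inter (hm hB)
  rw [← hc.measure_preimage hS.nullMeasurableSet, ← hc.measure_preimage hB.nullMeasurableSet,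
    Measure.prod_apply_symm (hc.measurable hS), Measure.prod_apply_symm (hc.measurable hB),
    ← lintegral_const_mul _ (measurable_measure_prodMk_right (hc.measurable hB))]
  refine lintegral_congr fun V => ?_
  have hsl : MeasurableSet ((fun a : ℝ => consSeq a V) ⁻¹' B) :=
    (measurable_consSeq.comp (measurable_id.prodMk measurable_const)) hB
  have h := congrArg (fun m => m ((fun a : ℝ => consSeq a V) ⁻¹' B)) (expMeasure_memoryless hl ht)
  simp only [Measure.smul_apply, smul_eq_mul] at h
  refine Eq.trans ?_ h
  rw [Measure.map_apply (by fun_prop) hsl, Measure.restrict_apply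
    ((by fun_prop : Measurable fun a : ℝ => a - t) hsl)]
  congr 1
  ext a
  simp only [Set.mem_preimage, Set.mem_ofPred_eq, consSeq_zero, Set.mem_inter_iff, Set.mem_Ioi]
  rw [and_comm]
  have : Function.update (consSeq a V) 0 (a - t) = consSeq (a - t) V := by
    ext n; cases n <;> simp
  rw [this]

end Exponential

/-! ### The next ring and its measurability -/

variable {N : Type v}

instance instMeasurableSpaceClock : MeasurableSpace (Clock N) := ⊤

instance instDiscreteClock : DiscreteMeasurableSpace (Clock N) := ⟨fun _ => trivial⟩

/-- The clock that rings next and the waiting time until it rings. -/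
def nextRing [Nonempty N] (W : Clock N → ℕ → ℝ) : Clock N × ℝ :=
  (nextClock W, W (nextClock W) 0)

lemma nextClock_le [Nonempty N] [Finite N] (W : Clock N → ℕ → ℝ) (d : Clock N) :
    W (nextClock W) 0 ≤ W d 0 := by
  have : ∃ c : Clock N, ∀ d, W c 0 ≤ W d 0 := Finite.exists_min fun c => W c 0
  exact Classical.epsilon_spec this d

lemma nextClock_eq_of_lt [Nonempty N] [Finite N] {W : Clock N → ℕ → ℝ} {c : Clock N}
    (h : ∀ d, d ≠ c → W c 0 < W d 0) : nextClock W = c := by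
  by_contra hne
  exact absurd (nextClock_le W c) (not_le.2 (h _ hne))

lemma measurable_nextClock [Nonempty N] [Finite N] :
    Measurable (nextClock : (Clock N → ℕ → ℝ) → Clock N) := by
  have hS : Measurable fun W : Clock N → ℕ → ℝ => fun c : Clock N => ∀ d, W c 0 ≤ W d 0 := by
    refine measurable_pi_lambda _ fun c => ?_
    refine measurable_to_prop ?_
    have : (fun W : Clock N → ℕ → ℝ => ∀ d, W c 0 ≤ W d 0) ⁻¹' {True} =
        ⋂ d, {W | W c 0 ≤ W d 0} := by ext; simp
    rw [this]
    exact MeasurableSet.iInter fun d => measurableSet_le (by fun_prop) (by fun_prop)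
  have hD : Measurable fun p : Clock N → Prop => Classical.epsilon p :=
    measurable_of_countable _
  exact hD.comp hS

lemma measurable_eval_nextClock [Nonempty N] [Finite N] :
    Measurable fun W : Clock N → ℕ → ℝ => W (nextClock W) 0 := by
  have : Measurable fun p : Clock N × (Clock N → ℕ → ℝ) => p.2 p.1 0 :=
    measurable_from_prod_countable_right fun c => by
      change Measurable fun W : Clock N → ℕ → ℝ => W c 0
      fun_prop
  exact this.comp (measurable_nextClock.prodMk measurable_id)

@[fun_prop] lemma measurable_nextRing [Nonempty N] [Finite N] :
    Measurable (nextRing : (Clock N → ℕ → ℝ) → Clock N × ℝ) :=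
  measurable_nextClock.prodMk measurable_eval_nextClock

/-- The remaining waiting times of all clocks after the clock `c` has rung. -/
def advanceOn [DecidableEq N] (c : Clock N) (W : Clock N → ℕ → ℝ) : Clock N → ℕ → ℝ := fun d =>
  if d = c then fun k => W d (k + 1) else Function.update (W d) 0 (W d 0 - W c 0)

lemma measurable_advanceOn [DecidableEq N] (c : Clock N) : Measurable (advanceOn c) := by
  refine measurable_pi_lambda _ fun d => ?_
  unfold advanceOn
  split_ifs with h
  · fun_prop
  · exact measurable_update_zero_sub.comp
      ((by fun_prop : Measurable fun W : Clock N → ℕ → ℝ => (W c 0, W d)))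

@[fun_prop] lemma measurable_advance [Nonempty N] [Finite N] [DecidableEq N] :
    Measurable (advance : (Clock N → ℕ → ℝ) → _) := by
  have : Measurable fun p : Clock N × (Clock N → ℕ → ℝ) => advanceOn p.1 p.2 :=
    measurable_from_prod_countable_right fun c => measurable_advanceOn c
  exact this.comp (measurable_nextClock.prodMk measurable_id)

/-! ### Renewal of the clocks at the rings -/

section Law

variable [Fintype N] [DecidableEq N] {lam : ℝ}

/-- The law of the waiting times of all clocks. -/
abbrev waitsLaw (N : Type v) [Fintype N] [DecidableEq N] (lam : ℝ) :
    Measure (Clock N → ℕ → ℝ) := Measure.pi fun _ : Clock N => waitLaw lam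

lemma isProbabilityMeasure_waitsLaw (hl : 0 < lam) : IsProbabilityMeasure (waitsLaw N lam) := by
  have := isProbabilityMeasure_expMeasure hl
  infer_instance

lemma measurePreserving_eval_waits (hl : 0 < lam) (c : Clock N) (k : ℕ) :
    MeasurePreserving (fun W : Clock N → ℕ → ℝ => W c k) (waitsLaw N lam) (expMeasure lam) := by
  have := isProbabilityMeasure_expMeasure hl
  exact (measurePreserving_eval_infinitePi (fun _ : ℕ => expMeasure lam) k).comp
    (measurePreserving_eval (fun _ : Clock N => waitLaw lam) c)

lemma ae_waits_pos (hl : 0 < lam) : ∀ᵐ W ∂(waitsLaw N lam), ∀ c k, 0 < W c k := by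
  refine ae_all_iff.2 fun c => ae_all_iff.2 fun k => ?_
  exact (measurePreserving_eval_waits hl c k).quasiMeasurePreserving.ae (ae_pos_expMeasure hl)

/-- With the row of `c` fixed, a tie confines the independent wait of `d` to a single point, and the
exponential law has no atoms. Without ties `nextClock` involves no arbitrary choice. -/
lemma ae_waits_ne (hl : 0 < lam) :
    ∀ᵐ W ∂(waitsLaw N lam), ∀ c d : Clock N, d ≠ c → W c 0 ≠ W d 0 := by
  have := isProbabilityMeasure_expMeasure hl
  refine ae_all_iff.2 fun c => ae_all_iff.2 fun d => ?_
  by_cases hdc : d = c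
  · exact Filter.Eventually.of_forall fun _ h => absurd hdc h
  have hS : MeasurableSet {W : Clock N → ℕ → ℝ | W c 0 = W d 0} :=
    measurableSet_eq_fun (by fun_prop) (by fun_prop)
  have hu := measurePreserving_update_pi (waitLaw lam) c
  have h0 : waitsLaw N lam {W : Clock N → ℕ → ℝ | W c 0 = W d 0} = 0 := by
    rw [← hu.measure_preimage hS.nullMeasurableSet, Measure.measure_prod_null (hu.measurable hS)]
    refine Filter.Eventually.of_forall fun V => ?_
    have : (Prod.mk V ⁻¹' ((fun p : (ℕ → ℝ) × (Clock N → ℕ → ℝ) => Function.update p.2 c p.1) ⁻¹'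
        {W | W c 0 = W d 0})) = (fun W : Clock N → ℕ → ℝ => W d 0) ⁻¹' {V 0} := by
      ext W
      simp [Function.update_of_ne hdc, eq_comm]
    simp only [Pi.zero_apply]
    rw [this, (measurePreserving_eval_waits hl d 0).measure_preimage
      (measurableSet_singleton _).nullMeasurableSet]
    exact measure_singleton _
  filter_upwards [measure_eq_zero_iff_ae_notMem.1 h0] with W hW _ h
  exact hW h

/-- Joint law of the first ring, on the event that it is the ring of `c`, and of the waiting times
that remain after it, on boxes. -/
lemma waitsLaw_box (hl : 0 < lam) (c : Clock N) {E : Set ℝ} (hE : MeasurableSet E)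
    {B : Clock N → Set (ℕ → ℝ)} (hB : ∀ d, MeasurableSet (B d)) :
    waitsLaw N lam {W | (∀ d, d ≠ c → W c 0 < W d 0) ∧ W c 0 ∈ E ∧
        advanceOn c W ∈ Set.pi Set.univ B} =
      (∫⁻ a in E, ENNReal.ofReal (Real.exp (-(lam * a))) ^ (Fintype.card (Clock N) - 1)
        ∂(expMeasure lam)) * ∏ d, waitLaw lam (B d) := by
  have := isProbabilityMeasure_expMeasure hl
  set S := {W : Clock N → ℕ → ℝ | (∀ d, d ≠ c → W c 0 < W d 0) ∧ W c 0 ∈ E ∧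
        advanceOn c W ∈ Set.pi Set.univ B} with hS
  have hSm : MeasurableSet S := by
    have h1 : MeasurableSet {W : Clock N → ℕ → ℝ | ∀ d, d ≠ c → W c 0 < W d 0} := by
      simp only [Set.ofPred_forall]
      exact MeasurableSet.iInter fun d => MeasurableSet.iInter fun _ =>
        measurableSet_lt (by fun_prop) (by fun_prop)
    exact h1.inter (((by fun_prop : Measurable fun W : Clock N → ℕ → ℝ => W c 0) hE).inter
      (measurable_advanceOn c (MeasurableSet.univ_pi hB)))
  have hu := measurePreserving_update_pi (waitLaw lam) c
  have hc := measurePreserving_consSeq (expMeasure lam)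
  rw [← hu.measure_preimage hSm.nullMeasurableSet, Measure.prod_apply (hu.measurable hSm)]
  set K : ENNReal := ∏ d ∈ Finset.univ.erase c, waitLaw lam (B d) with hK
  set q : ℝ → ENNReal := fun a =>
    ENNReal.ofReal (Real.exp (-(lam * a))) ^ (Fintype.card (Clock N) - 1) with hq
  have hqm : Measurable q := by fun_prop
  have hpos : ∀ᵐ V ∂(waitLaw lam), 0 < V 0 :=
    (measurePreserving_eval_infinitePi (fun _ : ℕ => expMeasure lam) 0).quasiMeasurePreserving.ae
      (ae_pos_expMeasure hl)
  -- Given the row `V` of `c`, the conditions on the other clocks are independent of each other. By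
  -- memorylessness each of them contributes `exp (-λ * V 0)` times the measure of its box, whence
  -- the power with exponent one less than the number of clocks; the row `V` itself contributes
  -- indicators.
  have key : ∀ᵐ V ∂(waitLaw lam), Measure.pi (fun _ : Clock N => waitLaw lam)
      (Prod.mk V ⁻¹' ((fun p : (ℕ → ℝ) × (Clock N → ℕ → ℝ) => Function.update p.2 c p.1) ⁻¹' S)) =
      (E.indicator q (V 0) * (B c).indicator 1 (fun k => V (k + 1))) * K := by
    filter_upwards [hpos] with V hV
    by_cases h1 : V 0 ∈ E
    · by_cases h2 : (fun k => V (k + 1)) ∈ B c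
      · have : (Prod.mk V ⁻¹' ((fun p : (ℕ → ℝ) × (Clock N → ℕ → ℝ) =>
            Function.update p.2 c p.1) ⁻¹' S)) = Set.pi Set.univ (Function.update (fun d =>
              {U : ℕ → ℝ | V 0 < U 0 ∧ Function.update U 0 (U 0 - V 0) ∈ B d}) c Set.univ) := by
          ext W
          simp only [S, Set.mem_preimage, Set.mem_ofPred_eq, Set.mem_pi, Set.mem_univ,
            true_implies, Function.update_self, h1, true_and]
          constructor
          · rintro ⟨h3, h4⟩ d
            by_cases hd : d = c
            · subst hd; simp
            · have h3 := h3 d hd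
              have h4 := h4 d
              simp only [advanceOn, hd, if_false, Function.update_self,
                Function.update_of_ne hd] at h3 h4
              rw [Function.update_of_ne hd]
              exact ⟨h3, h4⟩
          · intro h
            refine ⟨fun d hd => ?_, fun d => ?_⟩
            · have := h d
              rw [Function.update_of_ne hd] at this
              rw [Function.update_of_ne hd]
              exact this.1
            · by_cases hd : d = c
              · subst hd
                simpa [advanceOn] using h2
              · have := h d
                rw [Function.update_of_ne hd] at this
                simpa [advanceOn, hd] using this.2
        rw [this, Measure.pi_pi, ← Finset.mul_prod_erase _ _ (Finset.mem_univ c),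
          Function.update_self, measure_univ, one_mul, Set.indicator_of_mem h1,
          Set.indicator_of_mem h2, Pi.one_apply, mul_one, hK, hq]
        simp only
        rw [← Finset.card_univ, ← Finset.card_erase_of_mem (Finset.mem_univ c),
          ← Finset.prod_const, ← Finset.prod_mul_distrib]
        refine Finset.prod_congr rfl fun d hd => ?_
        rw [Function.update_of_ne (Finset.ne_of_mem_erase hd), waitLaw_memoryless hl hV.le (hB d)]
      · rw [Set.indicator_of_notMem h2, mul_zero, zero_mul]
        convert measure_empty
        · ext W
          simp only [S, Set.mem_preimage, Set.mem_ofPred_eq, Set.mem_empty_iff_false, iff_false]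
          rintro ⟨-, -, h⟩
          exact h2 (by simpa [advanceOn] using h c (Set.mem_univ c))
        · infer_instance
    · rw [Set.indicator_of_notMem h1, zero_mul, zero_mul]
      convert measure_empty
      · ext W
        simp only [S, Set.mem_preimage, Set.mem_ofPred_eq, Set.mem_empty_iff_false, iff_false]
        rintro ⟨-, h, -⟩
        exact h1 (by simpa using h)
      · infer_instance
  have hm1 : Measurable (E.indicator q) := hqm.indicator hE
  have hm2 : Measurable ((B c).indicator (1 : (ℕ → ℝ) → ENNReal)) :=
    measurable_one.indicator (hB c)
  have hf : Measurable fun V : ℕ → ℝ =>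
      (E.indicator q (V 0) * (B c).indicator 1 (fun k => V (k + 1))) * K := by fun_prop
  rw [lintegral_congr_ae key, ← hc.lintegral_comp hf]
  simp only [consSeq_zero, consSeq_succ]
  rw [lintegral_mul_const _ (by fun_prop), lintegral_prod_mul hm1.aemeasurable hm2.aemeasurable,
    lintegral_indicator hE, lintegral_indicator_one (hB c), mul_assoc,
    ← Finset.mul_prod_erase _ _ (Finset.mem_univ c)]

variable [Nonempty N]

/-- Just after the first ring, the clocks are as good as new. -/
lemma map_nextRing_advance (hl : 0 < lam) :
    (waitsLaw N lam).map (fun W => (nextRing W, advance W)) =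
      ((waitsLaw N lam).map nextRing).prod (waitsLaw N lam) := by
  have := isProbabilityMeasure_expMeasure hl
  have := isProbabilityMeasure_waitsLaw (N := N) hl
  have hpr : IsProbabilityMeasure ((waitsLaw N lam).map nextRing) :=
    Measure.isProbabilityMeasure_map measurable_nextRing.aemeasurable
  have hJ : Measurable fun W : Clock N → ℕ → ℝ => (nextRing W, advance W) := by fun_prop
  -- Up to the null event of a tie, the event splits according to the clock that rings first. The
  -- product over the boxes is the same for all clocks, so it factors out of the sum.
  have hbox : ∀ s : Set (Clock N × ℝ), MeasurableSet s → ∀ B : Clock N → Set (ℕ → ℝ),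
      (∀ d, MeasurableSet (B d)) →
      waitsLaw N lam ((fun W => (nextRing W, advance W)) ⁻¹' (s ×ˢ Set.pi Set.univ B)) =
        (∑ c : Clock N, ∫⁻ a in Prod.mk c ⁻¹' s,
          ENNReal.ofReal (Real.exp (-(lam * a))) ^ (Fintype.card (Clock N) - 1)
            ∂(expMeasure lam)) * ∏ d, waitLaw lam (B d) := by
    intro s hs B hB
    have hEm : ∀ c : Clock N, MeasurableSet (Prod.mk c ⁻¹' s) := fun c =>
      measurable_prodMk_left hs
    rw [Finset.sum_mul, ← Finset.sum_congr rfl fun c _ => waitsLaw_box hl c (hEm c) hB,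
      ← measure_biUnion_finset]
    · refine measure_congr ?_
      filter_upwards [ae_waits_ne (N := N) hl] with W hW
      refine propext ⟨fun h => ?_, fun h => ?_⟩
      · refine Set.mem_iUnion₂.2 ⟨nextClock W, Finset.mem_univ _, fun d hd => ?_, h.1, h.2⟩
        exact lt_of_le_of_ne (nextClock_le W d) (hW _ _ hd)
      · obtain ⟨c, -, h1, h2, h3⟩ := Set.mem_iUnion₂.1 h
        obtain rfl := nextClock_eq_of_lt h1
        exact ⟨h2, h3⟩
    · intro c _ d _ hcd
      refine Set.disjoint_left.2 fun W h1 h2 => ?_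
      exact lt_asymm (h1.1 d hcd.symm) (h2.1 c hcd)
    · intro c _
      have h1 : MeasurableSet {W : Clock N → ℕ → ℝ | ∀ d, d ≠ c → W c 0 < W d 0} := by
        simp only [Set.ofPred_forall]
        exact MeasurableSet.iInter fun d => MeasurableSet.iInter fun _ =>
          measurableSet_lt (by fun_prop) (by fun_prop)
      exact h1.inter (((by fun_prop : Measurable fun W : Clock N → ℕ → ℝ => W c 0) (hEm c)).inter
        (measurable_advanceOn c (MeasurableSet.univ_pi hB)))
  refine (Measure.prod_eq_generateFrom MeasurableSpace.generateFrom_measurableSet generateFrom_pi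
    MeasurableSpace.isPiSystem_measurableSet isPiSystem_pi
    (Measure.toFiniteSpanningSetsIn _) ⟨fun _ => Set.univ, fun _ => ?_, fun _ => ?_, ?_⟩ ?_).symm
  · exact ⟨fun _ => Set.univ, fun _ _ => by simp, by simp⟩
  · exact measure_lt_top _ _
  · exact Set.iUnion_const _
  · rintro s (hs : MeasurableSet s) _ ⟨B, hB, rfl⟩
    have hB' : ∀ d, MeasurableSet (B d) := fun d => hB d (Set.mem_univ d)
    have h1 := hbox s hs B hB'
    -- With full boxes the formula identifies the sum as the law of the first ring.
    have h2 := hbox s hs (fun _ => Set.univ) fun _ => MeasurableSet.univ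
    rw [Measure.map_apply hJ (hs.prod (MeasurableSet.univ_pi hB')), h1,
      Measure.map_apply measurable_nextRing hs, Measure.pi_pi]
    congr 1
    simp only [measure_univ, Finset.prod_const_one, mul_one, Set.pi_univ] at h2
    rw [← h2]
    congr 1
    ext W; simp

/-- The sequence of the first `n` rings, as determined by the waiting times. -/
def pastRings (n : ℕ) (W : Clock N → ℕ → ℝ) : ℕ → Clock N × ℝ := fun k =>
  -- A fixed value after the first `n` rings keeps the sequence free of information about the
  -- future, while its type does not depend on `n`.
  if k < n then nextRing (advance^[k] W) else nextRing fun _ _ => 0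

omit [Fintype N] in
lemma pastRings_of_lt {n k : ℕ} (h : k < n) (W : Clock N → ℕ → ℝ) :
    pastRings n W k = nextRing (advance^[k] W) := if_pos h

lemma measurable_pastRings (n : ℕ) : Measurable (pastRings n : (Clock N → ℕ → ℝ) → _) := by
  refine measurable_pi_lambda _ fun k => ?_
  unfold pastRings
  split_ifs
  · exact measurable_nextRing.comp (measurable_advance.iterate k)
  · exact measurable_const

/-- The rings after the `n`-th one are independent of the first `n` rings, and the clocks are as
good as new. -/
lemma exists_map_pastRings_advance (hl : 0 < lam) (n : ℕ) :
    ∃ π : Measure (ℕ → Clock N × ℝ), IsProbabilityMeasure π ∧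
      (waitsLaw N lam).map (fun W => (pastRings n W, advance^[n] W)) =
        π.prod (waitsLaw N lam) := by
  have := isProbabilityMeasure_waitsLaw (N := N) hl
  have hpr : IsProbabilityMeasure ((waitsLaw N lam).map nextRing) :=
    Measure.isProbabilityMeasure_map measurable_nextRing.aemeasurable
  induction n with
  | zero =>
    refine ⟨Measure.dirac fun _ => nextRing fun _ _ => 0, inferInstance, ?_⟩
    rw [Measure.dirac_prod]
    rfl
  | succ n ih =>
    obtain ⟨π, hπ, h⟩ := ih
    -- The new ring replaces the default value in slot `n`. It is a function of the clocks after `n`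
    -- rings, which by induction are fresh and independent of the past.
    set up : (ℕ → Clock N × ℝ) × (Clock N × ℝ) → ℕ → Clock N × ℝ :=
      fun p => Function.update p.1 n p.2 with hup
    have hupm : Measurable up := by
      refine measurable_pi_lambda _ fun k => ?_
      by_cases hk : k = n
      · subst hk; simp only [up, Function.update_self]; fun_prop
      · simp only [up, Function.update_of_ne hk]; fun_prop
    refine ⟨(π.prod ((waitsLaw N lam).map nextRing)).map up,
      Measure.isProbabilityMeasure_map hupm.aemeasurable, ?_⟩
    have hnr : Measurable fun W : Clock N → ℕ → ℝ => (nextRing W, advance W) := by fun_prop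
    have hassoc := (MeasureTheory.measurePreserving_prodAssoc π ((waitsLaw N lam).map nextRing)
      (waitsLaw N lam)).symm.map_eq
    have hcomp : (fun W : Clock N → ℕ → ℝ => (pastRings (n + 1) W, advance^[n + 1] W)) =
        Prod.map up id ∘ (MeasurableEquiv.prodAssoc.symm) ∘
          Prod.map id (fun W => (nextRing W, advance W)) ∘
          fun W => (pastRings n W, advance^[n] W) := by
      funext W
      refine Prod.ext ?_ (Function.iterate_succ_apply' _ _ _)
      funext k
      change _ = Function.update (pastRings n W) n (nextRing (advance^[n] W)) k
      by_cases hk : k = n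
      · subst hk; simp [pastRings]
      · rw [Function.update_of_ne hk]
        by_cases hk' : k < n
        · rw [pastRings_of_lt hk']; exact pastRings_of_lt (by omega) W
        · simp [pastRings, hk', show ¬ k < n + 1 by omega]
    have hpa : Measurable fun W : Clock N → ℕ → ℝ => (pastRings n W, advance^[n] W) :=
      (measurable_pastRings n).prodMk (measurable_advance.iterate n)
    rw [hcomp, ← Measure.map_map (hupm.prodMap measurable_id) (by fun_prop),
      ← Measure.map_map (by fun_prop) (by fun_prop), ← Measure.map_map (by fun_prop) hpa, h,
      ← Measure.map_prod_map _ _ measurable_id hnr, map_nextRing_advance hl, Measure.map_id,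
      hassoc, ← Measure.map_prod_map _ _ hupm measurable_id, Measure.map_id]

/-- Expectation of the discount factor until the next ring. -/
lemma lintegral_exp_expMeasure_le (hl : 0 < lam) {r : ℝ} (hr : 0 < r) :
    ∫⁻ a, ENNReal.ofReal (Real.exp (-(r * a))) ∂(expMeasure lam) ≤ ENNReal.ofReal (lam / r) := by
  have hpdf : expMeasure lam = volume.withDensity (exponentialPDF lam) := rfl
  have hm : Measurable (exponentialPDF lam) :=
    (measurable_exponentialPDFReal lam).ennreal_ofReal
  rw [hpdf, lintegral_withDensity_eq_lintegral_mul _ hm (by fun_prop)]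
  calc ∫⁻ a, (exponentialPDF lam * fun a => ENNReal.ofReal (Real.exp (-(r * a)))) a
      ≤ ∫⁻ a, ENNReal.ofReal (lam / r) * exponentialPDF r a := by
        -- Dropping the factor `exp (-λ * a)` leaves `λ / r` times an exponential density of rate
        -- `r`.
        refine lintegral_mono fun a => ?_
        simp only [Pi.mul_apply, exponentialPDF_eq]
        split_ifs with ha
        · rw [← ENNReal.ofReal_mul (by positivity), ← ENNReal.ofReal_mul (by positivity)]
          refine ENNReal.ofReal_le_ofReal ?_
          have h1 : Real.exp (-(lam * a)) ≤ 1 := Real.exp_le_one_iff.2 (by nlinarith)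
          have h2 := Real.exp_pos (-(r * a))
          calc lam * Real.exp (-(lam * a)) * Real.exp (-(r * a))
              ≤ lam * 1 * Real.exp (-(r * a)) := by gcongr
            _ = lam / r * (r * Real.exp (-(r * a))) := by field_simp
        · simp
    _ = ENNReal.ofReal (lam / r) := by
        rw [lintegral_const_mul _ (by exact (measurable_exponentialPDFReal r).ennreal_ofReal),
          lintegral_exponentialPDF_eq_one hr, mul_one]

omit [DecidableEq N] in
lemma measurable_exp_wait {r : ℝ} :
    Measurable fun W : Clock N → ℕ → ℝ => Real.exp (-(r * (nextRing W).2)) :=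
  Real.measurable_exp.comp (measurable_nextRing.snd.const_mul r).neg

lemma integrable_exp_wait (hl : 0 < lam) {r : ℝ} (hr : 0 < r) :
    Integrable (fun W : Clock N → ℕ → ℝ => Real.exp (-(r * (nextRing W).2))) (waitsLaw N lam) := by
  have := isProbabilityMeasure_waitsLaw (N := N) hl
  refine Integrable.mono' (integrable_const (1 : ℝ))
    measurable_exp_wait.aestronglyMeasurable ?_
  filter_upwards [ae_waits_pos (N := N) hl] with W hW
  rw [Real.norm_eq_abs, abs_of_pos (Real.exp_pos _), Real.exp_le_one_iff]
  have := hW (nextClock W) 0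
  simp only [nextRing]
  nlinarith

/-- The wait until the next ring is the wait of some clock, so its exponential is one term of the
sum over all clocks. The bound tends to zero with the rate, and this is the only way in which slow
clocks enter. -/
lemma integral_exp_wait_le (hl : 0 < lam) {r : ℝ} (hr : 0 < r) :
    ∫ W, Real.exp (-(r * (nextRing W).2)) ∂(waitsLaw N lam) ≤
      Fintype.card (Clock N) * (lam / r) := by
  rw [integral_eq_lintegral_of_nonneg_ae (Filter.Eventually.of_forall fun _ => (Real.exp_pos _).le)
    measurable_exp_wait.aestronglyMeasurable]
  refine ENNReal.toReal_le_of_le_ofReal (by positivity) ?_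
  calc ∫⁻ W, ENNReal.ofReal (Real.exp (-(r * (nextRing W).2))) ∂(waitsLaw N lam)
      ≤ ∫⁻ W, ∑ c : Clock N, ENNReal.ofReal (Real.exp (-(r * W c 0))) ∂(waitsLaw N lam) :=
        lintegral_mono fun W => Finset.single_le_sum
          (f := fun c => ENNReal.ofReal (Real.exp (-(r * W c 0)))) (fun _ _ => zero_le)
          (Finset.mem_univ (nextClock W))
    _ = ∑ c : Clock N, ∫⁻ a, ENNReal.ofReal (Real.exp (-(r * a))) ∂(expMeasure lam) := by
        rw [lintegral_finsetSum _ (by fun_prop)]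
        refine Finset.sum_congr rfl fun c _ => ?_
        exact (measurePreserving_eval_waits hl c 0).lintegral_comp
          (f := fun a => ENNReal.ofReal (Real.exp (-(r * a)))) (by fun_prop)
    _ ≤ ∑ c : Clock N, ENNReal.ofReal (lam / r) :=
        Finset.sum_le_sum fun c _ => lintegral_exp_expMeasure_le hl hr
    _ = ENNReal.ofReal (Fintype.card (Clock N) * (lam / r)) := by
        rw [Finset.sum_const, Finset.card_univ, nsmul_eq_mul, ENNReal.ofReal_mul (by positivity),
          ENNReal.ofReal_natCast]

omit [Nonempty N] in
/-- Almost surely, every clock has infinitely many waiting times that exceed `1`. -/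
lemma ae_frequently_one_lt (hl : 0 < lam) :
    ∀ᵐ W ∂(waitsLaw N lam), ∀ c : Clock N, ∃ᶠ k in Filter.atTop, 1 < W c k := by
  have := isProbabilityMeasure_expMeasure hl
  refine ae_all_iff.2 fun c => ?_
  have hind : iIndepSet (fun k : ℕ => (fun V : ℕ → ℝ => V k) ⁻¹' Set.Ioi 1) (waitLaw lam) := by
    have h : iIndepFun (fun (k : ℕ) (V : ℕ → ℝ) => id (V k)) (waitLaw lam) :=
      iIndepFun_infinitePi fun _ => measurable_id
    rw [iIndepSet_iff_meas_biInter fun k => measurable_pi_apply k measurableSet_Ioi]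
    intro s
    exact h.meas_biInter fun k _ => ⟨Set.Ioi 1, measurableSet_Ioi, rfl⟩
  have hk : ∀ k, waitLaw lam ((fun V : ℕ → ℝ => V k) ⁻¹' Set.Ioi 1) =
      ENNReal.ofReal (Real.exp (-(lam * 1))) := fun k => by
    rw [(measurePreserving_eval_infinitePi (fun _ : ℕ => expMeasure lam) k).measure_preimage
      measurableSet_Ioi.nullMeasurableSet, expMeasure_Ioi hl zero_le_one]
  -- Second Borel–Cantelli lemma: the events are independent with the same positive probability.
  have hone := measure_limsup_eq_one (fun k => measurable_pi_apply k measurableSet_Ioi) hind (by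
    simp only [hk]
    exact ENNReal.tsum_const_eq_top_of_ne_zero (by
      simp [Real.exp_pos]))
  have hae : ∀ᵐ V ∂(waitLaw lam), ∃ᶠ k in Filter.atTop, 1 < V k := by
    have hms : MeasurableSet (Filter.limsup
        (fun k : ℕ => (fun V : ℕ → ℝ => V k) ⁻¹' Set.Ioi (1 : ℝ)) Filter.atTop) :=
      MeasurableSet.measurableSet_limsup fun k => measurable_pi_apply k measurableSet_Ioi
    have := (prob_compl_eq_zero_iff hms).2 hone
    filter_upwards [measure_eq_zero_iff_ae_notMem.1 this] with V hV
    rw [Set.mem_compl_iff, not_not, Filter.mem_limsup_iff_frequently_mem] at hV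
    exact hV
  exact (measurePreserving_eval (fun _ : Clock N => waitLaw lam) c).quasiMeasurePreserving.ae hae

end Law

/-! ### Dates of the rings: no accumulation, and every clock keeps ringing -/

section RingTimes

variable {N : Type v} [Nonempty N] [DecidableEq N]

/-- Second marginal of the renewal property. It carries almost sure properties of fresh clocks over
to the clocks after any number of rings. -/
lemma measurePreserving_iterate_advance [Fintype N] {lam : ℝ} (hl : 0 < lam) (n : ℕ) :
    MeasurePreserving (advance^[n]) (waitsLaw N lam) (waitsLaw N lam) := by
  obtain ⟨π, hπ, h⟩ := exists_map_pastRings_advance (N := N) hl n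
  have := isProbabilityMeasure_waitsLaw (N := N) hl
  refine ⟨measurable_advance.iterate n, ?_⟩
  have h2 := congrArg (Measure.map Prod.snd) h
  rw [Measure.map_map measurable_snd
    ((measurable_pastRings n).prodMk (measurable_advance.iterate n)), Measure.map_snd_prod,
    measure_univ, one_smul] at h2
  exact h2

lemma ae_iterate_advance_pos [Fintype N] {lam : ℝ} (hl : 0 < lam) :
    ∀ᵐ W ∂(waitsLaw N lam), ∀ n c k, 0 < advance^[n] W c k :=
  ae_all_iff.2 fun n =>
    (measurePreserving_iterate_advance hl n).quasiMeasurePreserving.ae (ae_waits_pos hl)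

/-- The waiting time until the `n`-th ring. -/
def ringTime (W : Clock N → ℕ → ℝ) (n : ℕ) : ℝ :=
  ∑ k ∈ Finset.range n, (nextRing (advance^[k] W)).2

/-- Both sides of the first identity are the date of the next ring of `c`, computed from the
residual wait and from the original waits of `c`. The second identity says that the waits after the
current one are still untouched. -/
lemma advance_invariant (W : Clock N → ℕ → ℝ) (c : Clock N) (n : ℕ) :
    (advance^[n] W c 0 + ringTime W n =
      ∑ k ∈ Finset.range (Nat.count (fun k => nextClock (advance^[k] W) = c) n + 1), W c k) ∧
    ∀ j, advance^[n] W c (j + 1) =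
      W c (Nat.count (fun k => nextClock (advance^[k] W) = c) n + j + 1) := by
  induction n with
  | zero => simp [ringTime]
  | succ n ih =>
    obtain ⟨h1, h2⟩ := ih
    have hT : ringTime W (n + 1) =
        ringTime W n + advance^[n] W (nextClock (advance^[n] W)) 0 := by
      simp [ringTime, Finset.sum_range_succ, nextRing]
    rw [Function.iterate_succ_apply', Nat.count_succ, hT]
    by_cases hc : nextClock (advance^[n] W) = c
    · have ha : advance (advance^[n] W) c = fun k => advance^[n] W c (k + 1) := by
        simp [advance, hc]
      rw [if_pos hc, ha, hc]
      refine ⟨?_, fun j => ?_⟩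
      · rw [Finset.sum_range_succ, ← h1]
        simp only [h2]
        ring_nf
      · simp only [h2]
        ring_nf
    · have ha : advance (advance^[n] W) c = Function.update (advance^[n] W c) 0
          (advance^[n] W c 0 - advance^[n] W (nextClock (advance^[n] W)) 0) := by
        simp [advance, Ne.symm hc]
      rw [if_neg hc, ha, Function.update_self]
      refine ⟨?_, fun j => ?_⟩
      · rw [add_zero, ← h1]; ring
      · simpa using h2 j

/-- By the pigeonhole principle some clock rings infinitely often. The dates of its rings are the
partial sums of its waits, which diverge since infinitely many of them exceed `1`. -/
lemma exists_lt_ringTime [Finite N] {W : Clock N → ℕ → ℝ} (hpos : ∀ c k, 0 < W c k)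
    (hfreq : ∀ c, ∃ᶠ k in Filter.atTop, 1 < W c k) (b : ℝ) : ∃ n, b < ringTime W n := by
  obtain ⟨d, hd⟩ : ∃ d : Clock N, {k | nextClock (advance^[k] W) = d}.Infinite := by
    obtain ⟨d, hd⟩ := Finite.exists_infinite_fiber fun k : ℕ => nextClock (advance^[k] W)
    exact ⟨d, Set.infinite_coe_iff.1 hd⟩
  have hsum : Filter.Tendsto (fun m => ∑ k ∈ Finset.range m, W d k) Filter.atTop Filter.atTop := by
    refine (not_summable_iff_tendsto_nat_atTop_of_nonneg fun k => (hpos d k).le).1 fun hs => ?_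
    have h1 := hs.tendsto_atTop_zero.eventually (gt_mem_nhds zero_lt_one)
    obtain ⟨k, h2, h3⟩ := ((hfreq d).and_eventually h1).exists
    exact lt_asymm h2 h3
  obtain ⟨m, hm⟩ := ((Filter.tendsto_add_atTop_iff_nat 1).2 hsum |>.eventually
    (Filter.eventually_gt_atTop b)).exists
  -- Occurrences are counted from zero: at the end of the step in which `d` rings for the `m`-th
  -- time, `m + 1` waits of `d` have elapsed.
  refine ⟨Nat.nth (fun k => nextClock (advance^[k] W) = d) m + 1, ?_⟩
  have hmem : nextClock (advance^[Nat.nth (fun k => nextClock (advance^[k] W) = d) m] W) = d :=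
    Nat.nth_mem_of_infinite hd m
  have h1 := (advance_invariant W d (Nat.nth (fun k => nextClock (advance^[k] W) = d) m)).1
  rw [Nat.count_nth_of_infinite hd] at h1
  rw [ringTime, Finset.sum_range_succ, ← ringTime, nextRing, hmem, add_comm, h1]
  exact hm

/-- If `c` never rang after `n` rings, the date of its next ring would stay fixed and would bound
all later ring dates, which are unbounded. -/
lemma exists_nextClock_eq [Finite N] {W : Clock N → ℕ → ℝ}
    (hpos : ∀ n c k, 0 < advance^[n] W c k)
    (hfreq : ∀ c, ∃ᶠ k in Filter.atTop, 1 < W c k) (c : Clock N) (n : ℕ) :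
    ∃ m ≥ n, nextClock (advance^[m] W) = c := by
  by_contra! h
  have hcount : ∀ m ≥ n, Nat.count (fun k => nextClock (advance^[k] W) = c) m =
      Nat.count (fun k => nextClock (advance^[k] W) = c) n := by
    intro m hm
    induction m, hm using Nat.le_induction with
    | base => rfl
    | succ m hm ih => rw [Nat.count_succ, if_neg (h m hm), add_zero, ih]
  obtain ⟨m, hm⟩ := exists_lt_ringTime (W := W) (hpos 0) hfreq
    (advance^[n] W c 0 + ringTime W n)
  have hmono : Monotone (ringTime W) := monotone_nat_of_le_succ fun k => by
    rw [ringTime, ringTime, Finset.sum_range_succ]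
    have := hpos k (nextClock (advance^[k] W)) 0
    simp only [nextRing]
    linarith
  have hmn : n ≤ m := by
    by_contra hlt
    have h1 := hmono (not_le.1 hlt).le
    have := hpos n c 0
    linarith
  have h1 := (advance_invariant W c m).1
  rw [hcount m hmn, ← (advance_invariant W c n).1] at h1
  have := hpos m c 0
  linarith

end RingTimes

/-! ### Measurability of random histories, outcomes and moves -/

section MeasurableHistories

variable {N : Type v} {S : N → Type w}

instance instMeasurableSpaceMove : MeasurableSpace (Move N S) := ⊤

instance instDiscreteMove : DiscreteMeasurableSpace (Move N S) := ⟨fun _ => trivial⟩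

instance instMeasurableSpaceOutcome : MeasurableSpace (Outcome N S) := ⊤

instance instDiscreteOutcome : DiscreteMeasurableSpace (Outcome N S) := ⟨fun _ => trivial⟩

instance instFiniteMove [Finite N] [∀ i, Finite (S i)] : Finite (Move N S) := by
  let f : Move N S → (Σ i, S i) ⊕ (Fin 4 × N × N) := fun m =>
    match m with
    | .setAction i a => .inl ⟨i, a⟩
    | .pass i j => .inr (0, i, j)
    | .delete i j => .inr (1, i, j)
    | .accepted i j => .inr (2, i, j)
    | .rejected i j => .inr (3, i, j)
  refine Finite.of_injective f fun a b hab => ?_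
  cases a <;> cases b <;> simp_all [f]

variable {Ω : Type*} [MeasurableSpace Ω]

/-- A random history of length `L` is measurable if its times and its moves are. -/
def MeasurableHistory (L : ℕ) (H : Ω → History N S) : Prop :=
  ∃ (τ : Ω → Fin L → ℝ) (M : Ω → Fin L → Move N S), Measurable τ ∧ Measurable M ∧
    ∀ ω, H ω = List.ofFn fun k => (τ ω k, M ω k)

lemma measurableHistory_const (h : History N S) :
    MeasurableHistory h.length fun _ : Ω => h :=
  ⟨fun _ k => (h.get k).1, fun _ k => (h.get k).2, measurable_const, measurable_const,
    fun _ => (List.ofFn_get h).symm⟩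

lemma MeasurableHistory.cons {L : ℕ} {H : Ω → History N S} (hH : MeasurableHistory L H)
    {t : Ω → ℝ} (ht : Measurable t) {m : Ω → Move N S} (hm : Measurable m) :
    MeasurableHistory (L + 1) fun ω => (t ω, m ω) :: H ω := by
  obtain ⟨τ, M, hτ, hM, h⟩ := hH
  refine ⟨fun ω => Fin.cons (t ω) (τ ω), fun ω => Fin.cons (m ω) (M ω), ?_, ?_, fun ω => ?_⟩
  · refine measurable_pi_lambda _ fun k => ?_
    refine Fin.cases ?_ (fun k => ?_) k
    · simpa using ht
    · simp only [Fin.cons_succ]; fun_prop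
  · refine measurable_pi_lambda _ fun k => ?_
    refine Fin.cases ?_ (fun k => ?_) k
    · simpa using hm
    · simp only [Fin.cons_succ]; fun_prop
  · change (t ω, m ω) :: H ω = _
    rw [h ω, List.ofFn_succ]
    simp

variable [Finite N] [∀ i, Finite (S i)]

lemma MeasurableRule.comp {D : Type*} {f : History N S → ℝ → unitInterval → D}
    (hf : MeasurableRule f) {L : ℕ} {H : Ω → History N S} (hH : MeasurableHistory L H)
    {t : Ω → ℝ} (ht : Measurable t) {r : Ω → unitInterval} (hr : Measurable r) :
    @Measurable _ D _ ⊤ fun ω => f (H ω) (t ω) (r ω) := by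
  let _ : MeasurableSpace D := ⊤
  obtain ⟨τ, M, hτ, hM, h⟩ := hH
  -- There are finitely many sequences of `L` moves, so measurability in the dates and the draw for
  -- each fixed sequence gives joint measurability.
  have h1 : Measurable fun p : (Fin L → Move N S) × ((Fin L → ℝ) × ℝ × unitInterval) =>
      f (List.ofFn fun k => (p.2.1 k, p.1 k)) p.2.2.1 p.2.2.2 :=
    measurable_from_prod_countable_right fun m => hf L m
  have h2 : (fun ω => f (H ω) (t ω) (r ω)) =
      (fun p : (Fin L → Move N S) × ((Fin L → ℝ) × ℝ × unitInterval) =>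
        f (List.ofFn fun k => (p.2.1 k, p.1 k)) p.2.2.1 p.2.2.2) ∘
      fun ω => (M ω, τ ω, t ω, r ω) := by
    funext ω; simp [h ω]
  rw [h2]
  exact h1.comp (by fun_prop)

variable [DecidableEq N] (Γ : RevisionGame N S)

omit [Finite N] [∀ i, Finite (S i)] in
lemma RevisionGame.state_congr (Γ' : RevisionGame N S) (h0 : Γ.initial = Γ'.initial)
    {h h' : History N S} (hh : h.map Prod.snd = h'.map Prod.snd) : Γ.state h = Γ'.state h' := by
  induction h generalizing h' with
  | nil =>
    obtain rfl : h' = [] := by simpa using hh.symm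
    exact h0
  | cons e h ih =>
    cases h' with
    | nil => simp at hh
    | cons e' h' =>
      simp only [List.map_cons, List.cons.injEq] at hh
      simp only [RevisionGame.state, hh.1, ih hh.2]

lemma measurable_state {L : ℕ} {H : Ω → History N S} (hH : MeasurableHistory L H) :
    Measurable fun ω => Γ.state (H ω) := by
  obtain ⟨τ, M, hτ, hM, h⟩ := hH
  -- The outcome ignores the dates, so they are replaced by `0`; what remains is a function on a
  -- finite set.
  have h2 : (fun ω => Γ.state (H ω)) =
      (fun m : Fin L → Move N S => Γ.state (List.ofFn fun k => (0, m k))) ∘ M := by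
    funext ω
    refine Γ.state_congr Γ rfl ?_
    rw [h ω, List.map_ofFn, List.map_ofFn]
    rfl
  rw [h2]
  exact (measurable_of_countable _).comp hM

lemma measurable_move (σ : Profile N S) {L : ℕ} {H : Ω → History N S}
    (hH : MeasurableHistory L H) {t : Ω → ℝ} (ht : Measurable t) {c : Ω → Clock N}
    (hc : Measurable c) {r : Ω → unitInterval × unitInterval} (hr : Measurable r) :
    Measurable fun ω => Γ.move σ (H ω) (t ω) (c ω) (r ω) := by
  have h1 : ∀ c : Clock N, Measurable fun ω => Γ.move σ (H ω) (t ω) c (r ω) := by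
    rintro (i | ⟨⟨i, j⟩, hij⟩)
    · let _ : MeasurableSpace (S i) := ⊤
      exact (measurable_from_top (f := Move.setAction (N := N) (S := S) i)).comp
        ((σ i).measurable_act.comp hH ht hr.fst)
    · have hl : Measurable fun ω => (σ i).link j (H ω) (t ω) (r ω).1 :=
        ((σ i).measurable_link j).comp hH ht hr.fst
      have ha : Measurable fun ω => (σ j).respond i (H ω) (t ω) (r ω).2 :=
        ((σ j).measurable_respond i).comp hH ht hr.snd
      classical
      exact (Measurable.of_discrete (f := fun p : Bool × Bool × Outcome N S =>
        if p.1 then if p.2.2.1.Adj i j then Move.delete i j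
          else if p.2.1 then Move.accepted i j else Move.rejected i j
        else Move.pass i j)).comp (hl.prodMk (ha.prodMk (measurable_state Γ hH)))
  have h2 : Measurable fun p : Clock N × Ω => Γ.move σ (H p.2) (t p.2) p.1 (r p.2) :=
    measurable_from_prod_countable_right h1
  exact h2.comp (hc.prodMk measurable_id)

omit [DecidableEq N] in
lemma measurable_answer (σ : Profile N S) {L : ℕ} {H : Ω → History N S}
    (hH : MeasurableHistory L H) {t : Ω → ℝ} (ht : Measurable t) (i j : N)
    {r : Ω → unitInterval} (hr : Measurable r) :
    Measurable fun ω => RevisionGame.answer σ (H ω) (t ω) i j (r ω) := by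
  have ha : Measurable fun ω => (σ j).respond i (H ω) (t ω) (r ω) :=
    ((σ j).measurable_respond i).comp hH ht hr
  exact (Measurable.of_discrete (f := fun b : Bool =>
    if b then Move.accepted i j else (Move.rejected i j : Move N S))).comp ha

end MeasurableHistories

/-! ### Play as a function of rings and draws -/

namespace RevisionGame

variable {N : Type v} {S : N → Type w} [DecidableEq N] (Γ : RevisionGame N S)

/-- The history and the time just after the `n`-th ring from `(h, t)` on, given the sequence of
clocks that ring, the waiting times between the rings, and the random draws. -/
def run (σ : Profile N S) (h : History N S) (t : ℝ) (z : ℕ → Clock N × ℝ)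
    (d : ℕ → unitInterval × unitInterval) : ℕ → History N S × ℝ
  | 0 => (h, t)
  | n + 1 =>
    (((run σ h t z d n).2 + (z n).2, Γ.move σ (run σ h t z d n).1
      ((run σ h t z d n).2 + (z n).2) (z n).1 (d n)) :: (run σ h t z d n).1,
      (run σ h t z d n).2 + (z n).2)

lemma run_time (σ : Profile N S) (h : History N S) (t : ℝ) (z : ℕ → Clock N × ℝ)
    (d : ℕ → unitInterval × unitInterval) (n : ℕ) :
    (Γ.run σ h t z d n).2 = t + ∑ k ∈ Finset.range n, (z k).2 := by
  induction n with
  | zero => simp [run]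
  | succ n ih => rw [run, Finset.sum_range_succ, ← add_assoc, ← ih]

/-- Play does not anticipate. This serves to resample draw `n` without changing the past, and to
replace all rings by the first `n` of them. -/
lemma run_congr (σ : Profile N S) (h : History N S) (t : ℝ) {z z' : ℕ → Clock N × ℝ}
    {d d' : ℕ → unitInterval × unitInterval} {n : ℕ} (hz : ∀ k < n, z k = z' k)
    (hd : ∀ k < n, d k = d' k) : Γ.run σ h t z d n = Γ.run σ h t z' d' n := by
  induction n with
  | zero => rfl
  | succ n ih =>
    rw [run, run, ih (fun k hk => hz k (by omega)) (fun k hk => hd k (by omega)),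
      hz n (by omega), hd n (by omega)]

lemma measurable_run [Finite N] [∀ i, Finite (S i)] {Ω : Type*} [MeasurableSpace Ω]
    (σ : Profile N S) {L : ℕ}
    {H : Ω → History N S} (hH : MeasurableHistory L H) (t : ℝ) {z : Ω → ℕ → Clock N × ℝ}
    (hz : Measurable z) {d : Ω → ℕ → unitInterval × unitInterval} (hd : Measurable d) (n : ℕ) :
    MeasurableHistory (L + n) (fun ω => (Γ.run σ (H ω) t (z ω) (d ω) n).1) ∧
      Measurable fun ω => (Γ.run σ (H ω) t (z ω) (d ω) n).2 := by
  induction n with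
  | zero => exact ⟨hH, measurable_const⟩
  | succ n ih =>
    obtain ⟨h1, h2⟩ := ih
    have hzn : Measurable fun ω => z ω n := by fun_prop
    have ht : Measurable fun ω => (Γ.run σ (H ω) t (z ω) (d ω) n).2 + (z ω n).2 :=
      h2.add hzn.snd
    exact ⟨h1.cons ht (measurable_move Γ σ h1 ht hzn.fst (by fun_prop)), ht⟩

variable [Nonempty N]

/-- The sequence of the rings. -/
def _root_.rings (W : Clock N → ℕ → ℝ) (k : ℕ) : Clock N × ℝ := nextRing (advance^[k] W)

@[fun_prop] lemma _root_.measurable_rings [Finite N] :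
    Measurable (rings : (Clock N → ℕ → ℝ) → _) :=
  measurable_pi_lambda _ fun k => measurable_nextRing.comp (measurable_advance.iterate k)

/-- The waits influence histories only through the rings, and the rings do not depend on the
strategies. This separates the clocks from the decisions. -/
lemma play_eq (σ : Profile N S) (p : Situation N S) (n : ℕ) :
    Γ.play σ p n = ⟨(Γ.run σ p.history p.time (rings p.waits) p.draws n).1,
      (Γ.run σ p.history p.time (rings p.waits) p.draws n).2, advance^[n] p.waits,
      fun k => p.draws (k + n)⟩ := by
  induction n with
  | zero => rfl
  | succ n ih =>
    have h1 : Γ.play σ p (n + 1) = Γ.step σ (Γ.play σ p n) := Function.iterate_succ_apply' _ _ _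
    rw [h1, ih, step, Function.iterate_succ_apply']
    simp only [zero_add]
    simp [run, rings, nextRing, add_assoc, add_comm 1 n]

lemma play_time (σ : Profile N S) (p : Situation N S) (n : ℕ) :
    (Γ.play σ p n).time = p.time + ringTime p.waits n := by
  rw [play_eq, run_time]; rfl

lemma outcomeAt_of_mem (σ : Profile N S) (p : Situation N S) {t : ℝ} {n : ℕ}
    (h1 : ∀ k < n, (Γ.play σ p (k + 1)).time ≤ t) (h2 : t < (Γ.play σ p (n + 1)).time) :
    Γ.outcomeAt σ p t = Γ.state (Γ.play σ p n).history := by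
  have H : ∃ n, t < (Γ.play σ p (n + 1)).time := ⟨n, h2⟩
  rw [outcomeAt, dif_pos H]
  congr
  exact (Nat.find_eq_iff H).2 ⟨h2, fun k hk => not_lt.2 (h1 k hk)⟩

lemma outcomeAt_of_forall_le (σ : Profile N S) (p : Situation N S) {t : ℝ}
    (h : ∀ n, (Γ.play σ p (n + 1)).time ≤ t) :
    Γ.outcomeAt σ p t = Γ.state p.history := by
  rw [outcomeAt, dif_neg]
  rintro ⟨n, hn⟩
  exact not_lt.2 (h n) hn

lemma outcomeAt_cases (σ : Profile N S) (p : Situation N S) (t : ℝ) :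
    (∃ n, (∀ k < n, (Γ.play σ p (k + 1)).time ≤ t) ∧ t < (Γ.play σ p (n + 1)).time) ∨
      ∀ n, (Γ.play σ p (n + 1)).time ≤ t := by
  classical
  by_cases H : ∃ n, t < (Γ.play σ p (n + 1)).time
  · exact Or.inl ⟨Nat.find H, fun k hk => not_lt.1 (Nat.find_min H hk), Nat.find_spec H⟩
  · exact Or.inr fun n => not_lt.1 fun h => H ⟨n, h⟩

lemma measurable_outcomeAt [Finite N] [∀ i, Finite (S i)] {Ω : Type*} [MeasurableSpace Ω]
    (σ : Profile N S) {L : ℕ} {H : Ω → History N S} (hH : MeasurableHistory L H) (t₀ : ℝ)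
    {W : Ω → Clock N → ℕ → ℝ} (hW : Measurable W)
    {d : Ω → ℕ → unitInterval × unitInterval} (hd : Measurable d) {t : Ω → ℝ}
    (ht : Measurable t) :
    Measurable fun ω => Γ.outcomeAt σ ⟨H ω, t₀, W ω, d ω⟩ (t ω) := by
  have hr := Γ.measurable_run σ hH t₀ (z := fun ω => rings (W ω)) (by fun_prop) hd
  have hT : ∀ n, Measurable fun ω => (Γ.play σ ⟨H ω, t₀, W ω, d ω⟩ n).time := fun n => by
    simp only [play_eq]; exact (hr n).2
  have hs : ∀ n, Measurable fun ω => Γ.state (Γ.play σ ⟨H ω, t₀, W ω, d ω⟩ n).history :=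
    fun n => by
      simp only [play_eq]; exact measurable_state Γ (hr n).1
  refine measurable_to_countable' fun y => ?_
  -- Countable partition by the number of rings up to `t`; the last set collects the samples with
  -- infinitely many, where `outcomeAt` takes its default value.
  have : (fun ω => Γ.outcomeAt σ ⟨H ω, t₀, W ω, d ω⟩ (t ω)) ⁻¹' {y} =
      (⋃ n, ((⋂ k, ⋂ (_ : k < n), {ω | (Γ.play σ ⟨H ω, t₀, W ω, d ω⟩ (k + 1)).time ≤ t ω}) ∩
        {ω | t ω < (Γ.play σ ⟨H ω, t₀, W ω, d ω⟩ (n + 1)).time}) ∩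
        (fun ω => Γ.state (Γ.play σ ⟨H ω, t₀, W ω, d ω⟩ n).history) ⁻¹' {y}) ∪
      ((⋂ n, {ω | (Γ.play σ ⟨H ω, t₀, W ω, d ω⟩ (n + 1)).time ≤ t ω}) ∩
        (fun ω => Γ.state (H ω)) ⁻¹' {y}) := by
    ext ω
    simp only [Set.mem_preimage, Set.mem_singleton_iff, Set.mem_union, Set.mem_iUnion,
      Set.mem_inter_iff, Set.mem_iInter, Set.mem_ofPred_eq]
    constructor
    · rintro rfl
      rcases Γ.outcomeAt_cases σ ⟨H ω, t₀, W ω, d ω⟩ (t ω) with ⟨n, h1, h2⟩ | h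
      · exact Or.inl ⟨n, ⟨h1, h2⟩, (Γ.outcomeAt_of_mem σ _ h1 h2).symm⟩
      · exact Or.inr ⟨h, (Γ.outcomeAt_of_forall_le σ _ h).symm⟩
    · rintro (⟨n, ⟨h1, h2⟩, h3⟩ | ⟨h1, h2⟩)
      · rw [← h3]; exact Γ.outcomeAt_of_mem σ _ h1 h2
      · rw [← h2]; exact Γ.outcomeAt_of_forall_le σ _ h1
  rw [this]
  refine MeasurableSet.union (MeasurableSet.iUnion fun n => ?_) ?_
  · exact ((MeasurableSet.iInter fun k => MeasurableSet.iInter fun _ =>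
      measurableSet_le (hT _) ht).inter (measurableSet_lt ht (hT _))).inter
      (hs n (measurableSet_singleton y))
  · exact (MeasurableSet.iInter fun n => measurableSet_le (hT _) ht).inter
      (measurable_state Γ hH (measurableSet_singleton y))

omit [Nonempty N] in
lemma exists_measurableHistory_start [Finite N] [∀ i, Finite (S i)] (σ : Profile N S)
    (ν : Node N S) : ∃ (L : ℕ) (H : Sample N → History N S)
      (d : Sample N → ℕ → unitInterval × unitInterval), MeasurableHistory L H ∧ Measurable d ∧
      ∀ ω, Γ.start σ ω ν = ⟨H ω, ν.time, ω.1, d ω⟩ := by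
  have hd : Measurable fun ω : Sample N => fun k => ω.2 (k + 1) := by fun_prop
  cases ν with
  | waiting h t =>
    exact ⟨_, _, fun ω => ω.2, measurableHistory_const h, measurable_snd, fun _ => rfl⟩
  | ring h t c =>
    exact ⟨_, _, _, (measurableHistory_const h).cons measurable_const
      (measurable_move Γ σ (measurableHistory_const h) measurable_const measurable_const
        (by fun_prop)), hd, fun _ => rfl⟩
  | proposal h t i j =>
    exact ⟨_, _, _, (measurableHistory_const h).cons measurable_const
      (measurable_answer σ (measurableHistory_const h) measurable_const i j
        (by fun_prop)), hd, fun _ => rfl⟩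

lemma measurable_outcomeAt_start [Finite N] [∀ i, Finite (S i)] (σ : Profile N S)
    (ν : Node N S) :
    Measurable fun p : Sample N × ℝ => Γ.outcomeAt σ (Γ.start σ p.1 ν) p.2 := by
  obtain ⟨L, H, d, hH, hd, h⟩ := Γ.exists_measurableHistory_start σ ν
  simp only [h]
  obtain ⟨τ, M, hτ, hM, h'⟩ := hH
  have hH' : MeasurableHistory L fun p : Sample N × ℝ => H p.1 :=
    ⟨fun p => τ p.1, fun p => M p.1, by fun_prop, by fun_prop, fun p => h' p.1⟩
  exact Γ.measurable_outcomeAt σ hH' ν.time (by fun_prop) (by fun_prop) measurable_snd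

end RevisionGame

/-! ### Comparison of discounted payoffs -/

lemma integrableOn_exp_Ioi {r : ℝ} (hr : 0 < r) (a T : ℝ) :
    IntegrableOn (fun t => Real.exp (-(r * (t - a)))) (Set.Ioi T) := by
  have h : (fun t => Real.exp (-(r * (t - a)))) = fun t => Real.exp (r * a) * Real.exp (-r * t) := by
    funext t; rw [← Real.exp_add]; ring_nf
  rw [h]
  exact (integrableOn_exp_mul_Ioi (neg_neg_of_pos hr) T).const_mul _

lemma setIntegral_exp_Ioi {r : ℝ} (hr : 0 < r) (a T : ℝ) :
    ∫ t in Set.Ioi T, Real.exp (-(r * (t - a))) = Real.exp (-(r * (T - a))) / r := by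
  have h : (fun t => Real.exp (-(r * (t - a)))) = fun t => Real.exp (r * a) * Real.exp (-r * t) := by
    funext t; rw [← Real.exp_add]; ring_nf
  rw [h, integral_const_mul, integral_exp_mul_Ioi (neg_neg_of_pos hr), neg_div_neg_eq,
    ← mul_div_assoc, ← Real.exp_add]
  ring_nf

/-- A flow payoff that falls short of another one by `Δ` between `T` and `T'` cannot make up for it
later if `T'` is late enough. -/
lemma discounted_sub_le {r : ℝ} (hr : 0 < r) {f g : ℝ → ℝ} {M Δ a T T' : ℝ}
    (hf : Measurable f) (hg : Measurable g) (hfM : ∀ t, |f t| ≤ M) (hgM : ∀ t, |g t| ≤ M)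
    (haT : a ≤ T) (hTT' : T ≤ T')
    (h1 : ∀ t, a < t → t < T → f t = g t) (h2 : ∀ t, T < t → t < T' → f t + Δ ≤ g t) :
    (∫ t in Set.Ioi a, Real.exp (-(r * (t - a))) * f t) -
        ∫ t in Set.Ioi a, Real.exp (-(r * (t - a))) * g t ≤
      Real.exp (-(r * (T - a))) / r * (-Δ + (Δ + 2 * M) * Real.exp (-(r * (T' - T)))) := by
  have hE : ∀ b, IntegrableOn (fun t => Real.exp (-(r * (t - a)))) (Set.Ioi b) :=
    integrableOn_exp_Ioi hr a
  have hfi : IntegrableOn (fun t => Real.exp (-(r * (t - a))) * f t) (Set.Ioi a) :=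
    (hE a).mul_bdd hf.aestronglyMeasurable (Filter.Eventually.of_forall hfM)
  have hgi : IntegrableOn (fun t => Real.exp (-(r * (t - a))) * g t) (Set.Ioi a) :=
    (hE a).mul_bdd hg.aestronglyMeasurable (Filter.Eventually.of_forall hgM)
  have hI : ∀ b, IntegrableOn
      ((Set.Ioi b).indicator fun t => Real.exp (-(r * (t - a)))) (Set.Ioi a) := fun b =>
    (hE a).indicator measurableSet_Ioi
  have hv : ∀ b, a ≤ b → ∫ t in Set.Ioi a, (Set.Ioi b).indicator
      (fun t => Real.exp (-(r * (t - a)))) t = Real.exp (-(r * (b - a))) / r := fun b hb => by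
    rw [setIntegral_indicator measurableSet_Ioi, Set.Ioi_inter_Ioi, sup_eq_right.2 hb,
      setIntegral_exp_Ioi hr]
  rw [← integral_sub hfi hgi]
  calc ∫ t in Set.Ioi a, (Real.exp (-(r * (t - a))) * f t - Real.exp (-(r * (t - a))) * g t)
      -- The difference of flows is zero before `T`, at most `-Δ` between `T` and `T'`, and at most
      -- `2 * M` afterwards; the two indicators encode exactly these bounds.
      ≤ ∫ t in Set.Ioi a,
          (-Δ * (Set.Ioi T).indicator (fun t => Real.exp (-(r * (t - a)))) t +
          (Δ + 2 * M) * (Set.Ioi T').indicator (fun t => Real.exp (-(r * (t - a)))) t) := by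
        refine integral_mono_ae (hfi.sub hgi) (((hI T).const_mul _).add ((hI T').const_mul _)) ?_
        have hT : ∀ᵐ t ∂(volume.restrict (Set.Ioi a)), t ≠ T :=
          ae_restrict_of_ae (compl_mem_ae_iff.2 (measure_singleton T))
        have hT' : ∀ᵐ t ∂(volume.restrict (Set.Ioi a)), t ≠ T' :=
          ae_restrict_of_ae (compl_mem_ae_iff.2 (measure_singleton T'))
        filter_upwards [hT, hT', ae_restrict_mem measurableSet_Ioi] with t ht ht' hta
        have hpos := Real.exp_pos (-(r * (t - a)))
        rcases lt_or_gt_of_ne ht with h | h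
        · rw [Set.indicator_of_notMem (by simpa using h.le),
            Set.indicator_of_notMem (by simpa using (h.trans_le hTT').le), h1 t hta h]
          simp
        · rw [Set.indicator_of_mem (show t ∈ Set.Ioi T from h)]
          rcases lt_or_gt_of_ne ht' with h' | h'
          · rw [Set.indicator_of_notMem (by simpa using h'.le)]
            have := h2 t h h'
            nlinarith
          · rw [Set.indicator_of_mem (show t ∈ Set.Ioi T' from h')]
            have := (abs_le.1 (hfM t)).2
            have := (abs_le.1 (hgM t)).1
            nlinarith
    _ = _ := by
        rw [integral_add ((hI T).const_mul _) ((hI T').const_mul _), integral_const_mul,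
          integral_const_mul, hv T haT, hv T' (haT.trans hTT'),
          show -(r * (T' - a)) = -(r * (T - a)) + -(r * (T' - T)) by ring, Real.exp_add]
        ring

lemma abs_discounted_le {r : ℝ} (hr : 0 < r) {f : ℝ → ℝ} {M : ℝ} (hfM : ∀ t, |f t| ≤ M) (a : ℝ) :
    |∫ t in Set.Ioi a, Real.exp (-(r * (t - a))) * f t| ≤ M / r := by
  have h := norm_integral_le_of_norm_le (μ := volume.restrict (Set.Ioi a))
    (f := fun t => Real.exp (-(r * (t - a))) * f t)
    ((integrableOn_exp_Ioi hr a a).mul_const M) (Filter.Eventually.of_forall fun t => by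
      rw [norm_mul, Real.norm_of_nonneg (Real.exp_pos _).le]
      exact mul_le_mul_of_nonneg_left (hfM t) (Real.exp_pos _).le)
  rw [integral_mul_const, setIntegral_exp_Ioi hr] at h
  simpa [div_eq_inv_mul] using h

section

variable {N : Type v} [Nonempty N] [DecidableEq N]

lemma ringTime_succ (W : Clock N → ℕ → ℝ) (n : ℕ) :
    ringTime W (n + 1) = ringTime W n + (nextRing (advance^[n] W)).2 := by
  rw [ringTime, Finset.sum_range_succ]; rfl

lemma ringTime_zero (W : Clock N → ℕ → ℝ) : ringTime W 0 = 0 := by simp [ringTime]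

lemma ringTime_strictMono {W : Clock N → ℕ → ℝ} (hW : ∀ n c k, 0 < advance^[n] W c k) :
    StrictMono (ringTime W) := strictMono_nat_of_lt_succ fun n => by
  rw [ringTime_succ]
  exact lt_add_of_pos_right _ (hW n _ 0)

end

namespace RevisionGame

variable {N : Type v} {S : N → Type w} [DecidableEq N] (Γ : RevisionGame N S)

/-- The discount rate. -/
def discountRate : ℝ := -Real.log Γ.discount

omit [DecidableEq N] in
lemma discountRate_pos : 0 < Γ.discountRate :=
  neg_pos.2 (Real.log_neg Γ.discount_pos Γ.discount_lt_one)

omit [DecidableEq N] in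
lemma discount_rpow (x : ℝ) : Γ.discount ^ x = Real.exp (-(Γ.discountRate * x)) := by
  rw [Real.rpow_def_of_pos Γ.discount_pos, discountRate, neg_mul, neg_neg]

variable [Nonempty N]

/-- The realized discounted payoff of player `i` in the subgame that begins at `ν`. -/
def pathValue (σ : Profile N S) (ν : Node N S) (i : N) (ω : Sample N) : ℝ :=
  ∫ t in Set.Ioi ν.time,
    Γ.discount ^ (t - ν.time) * Γ.payoff i (Γ.outcomeAt σ (Γ.start σ ω ν) t)

omit [Nonempty N] in
lemma start_time (σ : Profile N S) (ν : Node N S) (ω : Sample N) :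
    (Γ.start σ ω ν).time = ν.time := by cases ν <;> rfl

omit [Nonempty N] in
lemma start_waits (σ : Profile N S) (ν : Node N S) (ω : Sample N) :
    (Γ.start σ ω ν).waits = ω.1 := by cases ν <;> rfl

lemma play_start_time (σ : Profile N S) (ν : Node N S) (ω : Sample N) (n : ℕ) :
    (Γ.play σ (Γ.start σ ω ν) n).time = ν.time + ringTime ω.1 n := by
  rw [play_time, start_time, start_waits]

/-- The outcome after `n` rings in the subgame that begins at `ν`. -/
def stateAt (σ : Profile N S) (ν : Node N S) (ω : Sample N) (n : ℕ) : Outcome N S :=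
  Γ.state (Γ.play σ (Γ.start σ ω ν) n).history

/-- All profiles share the dates of the rings, so agreement after each number of rings is agreement
at each date. If infinitely many rings occur by `t`, both sides fall back on the outcome after `0`
rings. -/
lemma outcomeAt_congr {σ σ' : Profile N S} {ν : Node N S} {ω : Sample N}
    (h : ∀ n, Γ.stateAt σ' ν ω n = Γ.stateAt σ ν ω n) (t : ℝ) :
    Γ.outcomeAt σ' (Γ.start σ' ω ν) t = Γ.outcomeAt σ (Γ.start σ ω ν) t := by
  rcases Γ.outcomeAt_cases σ (Γ.start σ ω ν) t with ⟨n, h1, h2⟩ | h1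
  · rw [Γ.outcomeAt_of_mem σ _ h1 h2]
    simp only [play_start_time] at h1 h2
    rw [Γ.outcomeAt_of_mem σ' _ (by simpa only [play_start_time] using h1)
      (by simpa only [play_start_time] using h2)]
    exact h n
  · rw [Γ.outcomeAt_of_forall_le σ _ h1]
    simp only [play_start_time] at h1
    rw [Γ.outcomeAt_of_forall_le σ' _ (by simpa only [play_start_time] using h1)]
    exact h 0

lemma outcomeAt_start_of_mem {σ : Profile N S} {ν : Node N S} {ω : Sample N}
    (hW : ∀ n c k, 0 < advance^[n] ω.1 c k) {n : ℕ} {t : ℝ}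
    (h1 : ν.time + ringTime ω.1 n ≤ t) (h2 : t < ν.time + ringTime ω.1 (n + 1)) :
    Γ.outcomeAt σ (Γ.start σ ω ν) t = Γ.stateAt σ ν ω n := by
  refine Γ.outcomeAt_of_mem σ _ (fun k hk => ?_) (by rwa [play_start_time])
  rw [play_start_time]
  have := (ringTime_strictMono hW).monotone (show k + 1 ≤ n from hk)
  linarith

lemma pathValue_congr {σ σ' : Profile N S} {ν : Node N S} {ω : Sample N}
    (h : ∀ n, Γ.stateAt σ' ν ω n = Γ.stateAt σ ν ω n) (i : N) :
    Γ.pathValue σ' ν i ω = Γ.pathValue σ ν i ω := by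
  simp only [pathValue, Γ.outcomeAt_congr h]

variable [Finite N] [∀ i, Finite (S i)]

lemma measurable_payoff_outcomeAt (σ : Profile N S) (ν : Node N S) (i : N) :
    Measurable fun p : Sample N × ℝ => Γ.payoff i (Γ.outcomeAt σ (Γ.start σ p.1 ν) p.2) :=
  (Measurable.of_discrete (f := Γ.payoff i)).comp (Γ.measurable_outcomeAt_start σ ν)

/-- Pathwise core of both statements. It is used with `n = 0` for the decision pending at a node,
and with `n` the index of the first change of outcome for arbitrary deviations. -/
lemma pathValue_sub_le {σ σ' : Profile N S} {ν : Node N S} {ω : Sample N} {i : N} {M Δ : ℝ}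
    (hM : ∀ y, |Γ.payoff i y| ≤ M) (hW : ∀ n c k, 0 < advance^[n] ω.1 c k) {n : ℕ}
    (h1 : ∀ k < n, Γ.stateAt σ' ν ω k = Γ.stateAt σ ν ω k)
    (h2 : Γ.payoff i (Γ.stateAt σ' ν ω n) + Δ ≤ Γ.payoff i (Γ.stateAt σ ν ω n)) :
    Γ.pathValue σ' ν i ω - Γ.pathValue σ ν i ω ≤
      Real.exp (-(Γ.discountRate * ringTime ω.1 n)) / Γ.discountRate *
        (-Δ + (Δ + 2 * M) *
          Real.exp (-(Γ.discountRate * (nextRing (advance^[n] ω.1)).2))) := by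
  have hm := ringTime_strictMono hW
  have h0 : 0 ≤ ringTime ω.1 n := by
    rw [← ringTime_zero ω.1]; exact hm.monotone (Nat.zero_le n)
  have hmeas : ∀ σ : Profile N S, Measurable fun t =>
      Γ.payoff i (Γ.outcomeAt σ (Γ.start σ ω ν) t) := fun σ =>
    (Γ.measurable_payoff_outcomeAt σ ν i).comp (measurable_const.prodMk measurable_id)
  have h := discounted_sub_le Γ.discountRate_pos (hmeas σ') (hmeas σ) (fun _ => hM _)
    (fun _ => hM _) (a := ν.time) (T := ν.time + ringTime ω.1 n)
    (T' := ν.time + ringTime ω.1 (n + 1)) (Δ := Δ) (by linarith)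
    (by have := hm.monotone (Nat.le_succ n); linarith) (fun t ht1 ht2 => ?_) (fun t ht1 ht2 => ?_)
  · simp only [pathValue, discount_rpow]
    rwa [add_sub_cancel_left, ringTime_succ, show ν.time + (ringTime ω.1 n +
      (nextRing (advance^[n] ω.1)).2) - (ν.time + ringTime ω.1 n) =
      (nextRing (advance^[n] ω.1)).2 by ring] at h
  · congr 1
    have hn : n ≠ 0 := by
      rintro rfl; rw [ringTime_zero] at ht2; linarith
    rcases Γ.outcomeAt_cases σ (Γ.start σ ω ν) t with ⟨m, h3, h4⟩ | h3
    · simp only [play_start_time] at h3 h4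
      have hmn : m < n := by
        by_contra hlt
        have := h3 (n - 1) (by omega)
        rw [Nat.sub_add_cancel (Nat.pos_of_ne_zero hn)] at this
        linarith
      rw [Γ.outcomeAt_of_mem σ _ (by simpa only [play_start_time] using h3)
        (by simpa only [play_start_time] using h4), Γ.outcomeAt_of_mem σ' _
        (by simpa only [play_start_time] using h3) (by simpa only [play_start_time] using h4)]
      exact h1 m hmn
    · have := h3 (n - 1)
      rw [Nat.sub_add_cancel (Nat.pos_of_ne_zero hn), play_start_time] at this
      linarith
  · rwa [Γ.outcomeAt_start_of_mem hW ht1.le ht2, Γ.outcomeAt_start_of_mem hW ht1.le ht2]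

lemma measurable_pathValue (σ : Profile N S) (ν : Node N S) (i : N) :
    Measurable (Γ.pathValue σ ν i) := by
  have h : Measurable fun p : Sample N × ℝ => Γ.discount ^ (p.2 - ν.time) *
      Γ.payoff i (Γ.outcomeAt σ (Γ.start σ p.1 ν) p.2) := by
    have := Γ.measurable_payoff_outcomeAt σ ν i
    fun_prop
  exact (h.stronglyMeasurable.integral_prod_right
    (ν := volume.restrict (Set.Ioi ν.time))).measurable

omit [Finite N] [∀ i, Finite (S i)] in
lemma abs_pathValue_le {i : N} {M : ℝ} (hM : ∀ y, |Γ.payoff i y| ≤ M) (σ : Profile N S)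
    (ν : Node N S) (ω : Sample N) : |Γ.pathValue σ ν i ω| ≤ M / Γ.discountRate := by
  simp only [pathValue, discount_rpow]
  exact abs_discounted_le Γ.discountRate_pos (fun _ => hM _) _

lemma integrable_pathValue {i : N} {M : ℝ} (hM : ∀ y, |Γ.payoff i y| ≤ M) (σ : Profile N S)
    (ν : Node N S) (P : Measure (Sample N)) [IsFiniteMeasure P] :
    Integrable (Γ.pathValue σ ν i) P :=
  Integrable.mono' (integrable_const (M / Γ.discountRate))
    (Γ.measurable_pathValue σ ν i).aestronglyMeasurable
    (Filter.Eventually.of_forall (Γ.abs_pathValue_le hM σ ν))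

end RevisionGame

/-! ### The law of the random draws -/

lemma measurable_update_prod {ι X : Type*} [DecidableEq ι] [MeasurableSpace X] (n : ι) :
    Measurable fun p : (ι → X) × X => Function.update p.1 n p.2 := by
  refine measurable_pi_lambda _ fun k => ?_
  by_cases h : k = n
  · subst h; simpa using measurable_snd
  · simp only [Function.update_of_ne h]; fun_prop

/-- Resampling one coordinate does not change the law of an i.i.d. family. -/
lemma measurePreserving_update_infinitePi {ι X : Type*} [DecidableEq ι] [MeasurableSpace X]
    (μ : Measure X) [IsProbabilityMeasure μ] (n : ι) :
    MeasurePreserving (fun p : (ι → X) × X => Function.update p.1 n p.2)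
      ((Measure.infinitePi fun _ : ι => μ).prod μ) (Measure.infinitePi fun _ : ι => μ) := by
  have hm := measurable_update_prod (X := X) n
  refine ⟨hm, Measure.eq_infinitePi _ fun s t ht => ?_⟩
  rw [Measure.map_apply hm (MeasurableSet.pi s.countable_toSet fun k _ => ht k)]
  by_cases hn : n ∈ s
  · have hpre : (fun p : (ι → X) × X => Function.update p.1 n p.2) ⁻¹' Set.pi s t =
        Set.pi (s.erase n) t ×ˢ t n := by
      ext ⟨V, a⟩
      simp only [Set.mem_preimage, Set.mem_pi, Set.mem_prod, Finset.mem_coe]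
      constructor
      · intro h
        refine ⟨fun k hk => ?_, by simpa using h n hn⟩
        simpa [Finset.ne_of_mem_erase hk] using h k (Finset.mem_of_mem_erase hk)
      · rintro ⟨h1, h2⟩ k hk
        by_cases hkn : k = n
        · subst hkn; simpa using h2
        · simpa [hkn] using h1 k (Finset.mem_erase.2 ⟨hkn, hk⟩)
    rw [hpre, Measure.prod_prod, Measure.infinitePi_pi _ fun k _ => ht k,
      Finset.prod_erase_mul _ _ hn]
  · have hpre : (fun p : (ι → X) × X => Function.update p.1 n p.2) ⁻¹' Set.pi s t =
        Set.pi s t ×ˢ Set.univ := by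
      ext ⟨V, a⟩
      simp only [Set.mem_preimage, Set.mem_pi, Set.mem_prod, Finset.mem_coe, Set.mem_univ,
        and_true]
      refine forall₂_congr fun k hk => ?_
      rw [Function.update_of_ne (by rintro rfl; exact hn hk)]
    rw [hpre, Measure.prod_prod, Measure.infinitePi_pi _ fun k _ => ht k, measure_univ, mul_one]

/-- The law of the random draws. -/
abbrev drawsLaw : Measure (ℕ → unitInterval × unitInterval) :=
  Measure.infinitePi fun _ : ℕ => (volume : Measure (unitInterval × unitInterval))

lemma sampleLaw_eq (N : Type v) [Fintype N] [DecidableEq N] (rate : ℝ) :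
    sampleLaw N rate = (waitsLaw N rate).prod drawsLaw := rfl

lemma isProbabilityMeasure_sampleLaw {N : Type v} [Fintype N] [DecidableEq N] {rate : ℝ}
    (h : 0 < rate) : IsProbabilityMeasure (sampleLaw N rate) := by
  have := isProbabilityMeasure_waitsLaw (N := N) h
  rw [sampleLaw_eq]
  infer_instance

lemma ae_sampleLaw_fst {N : Type v} [Fintype N] [DecidableEq N] {rate : ℝ} (h : 0 < rate)
    {p : (Clock N → ℕ → ℝ) → Prop} (hp : ∀ᵐ W ∂(waitsLaw N rate), p W) :
    ∀ᵐ ω ∂(sampleLaw N rate), p ω.1 := by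
  have := isProbabilityMeasure_waitsLaw (N := N) h
  rw [sampleLaw_eq]
  exact Measure.quasiMeasurePreserving_fst.ae hp

lemma ae_sampleLaw_draw {N : Type v} [Fintype N] [DecidableEq N] {rate : ℝ} (h : 0 < rate)
    {B : Set (unitInterval × unitInterval)} (hB : volume B = 0) (n : ℕ) :
    ∀ᵐ ω ∂(sampleLaw N rate), ω.2 n ∉ B := by
  have := isProbabilityMeasure_waitsLaw (N := N) h
  rw [sampleLaw_eq]
  exact Measure.quasiMeasurePreserving_snd.ae ((measurePreserving_eval_infinitePi
    (fun _ : ℕ => (volume : Measure (unitInterval × unitInterval))) n).quasiMeasurePreserving.ae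
    (measure_eq_zero_iff_ae_notMem.1 hB))

/-! ### Corrections of a single decision -/

section Override

variable {N : Type v} {S : N → Type w}

/-- The strategy `σ`, except for the decisions after histories of length `L`. -/
def Strategy.override {i : N} (σ : Strategy N S i) (L : ℕ) (a : S i) (b : Bool) :
    Strategy N S i where
  act h t r := if h.length = L then a else σ.act h t r
  link j h t r := if h.length = L then b else σ.link j h t r
  respond j h t r := if h.length = L then b else σ.respond j h t r
  measurable_act n m := by
    simp only [List.length_ofFn]
    split_ifs
    · exact @measurable_const _ _ ⊤ _ _
    · exact σ.measurable_act n m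
  measurable_link j n m := by
    simp only [List.length_ofFn]
    split_ifs
    · exact @measurable_const _ _ ⊤ _ _
    · exact σ.measurable_link j n m
  measurable_respond j n m := by
    simp only [List.length_ofFn]
    split_ifs
    · exact @measurable_const _ _ ⊤ _ _
    · exact σ.measurable_respond j n m

namespace RevisionGame

variable [DecidableEq N] (Γ : RevisionGame N S)

lemma update_override_of_ne (σ : Profile N S) {i : N} {L : ℕ} (a : S i) (b : Bool)
    {h : History N S} (hL : h.length ≠ L) (k : N) :
    (Function.update σ i ((σ i).override L a b) k).act h = (σ k).act h ∧
    (∀ j, (Function.update σ i ((σ i).override L a b) k).link j h = (σ k).link j h) ∧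
    ∀ j, (Function.update σ i ((σ i).override L a b) k).respond j h = (σ k).respond j h := by
  by_cases hk : k = i
  · subst hk
    simp [Strategy.override, hL]
  · simp [Function.update_of_ne hk]

lemma move_override_of_ne (σ : Profile N S) {i : N} {L : ℕ} (a : S i) (b : Bool)
    {h : History N S} (hL : h.length ≠ L) (t : ℝ) (c : Clock N)
    (r : unitInterval × unitInterval) :
    Γ.move (Function.update σ i ((σ i).override L a b)) h t c r = Γ.move σ h t c r := by
  have H := fun k => update_override_of_ne σ a b hL k
  rcases c with k | ⟨⟨k, j⟩, hkj⟩
  · simp only [move, (H k).1]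
  · simp only [move, answer, (H k).2.1, (H j).2.2]

lemma length_run (σ : Profile N S) (h : History N S) (t : ℝ) (z : ℕ → Clock N × ℝ)
    (d : ℕ → unitInterval × unitInterval) (n : ℕ) :
    (Γ.run σ h t z d n).1.length = h.length + n := by
  induction n with
  | zero => rfl
  | succ n ih => simp [run, ih, add_assoc]

/-- Histories only grow, so once the history is longer than `L` the overridden decisions never
recur. -/
lemma run_override (σ : Profile N S) {i : N} {L : ℕ} (a : S i) (b : Bool)
    {h : History N S} (hL : L < h.length) (t : ℝ) (z : ℕ → Clock N × ℝ)
    (d : ℕ → unitInterval × unitInterval) (n : ℕ) :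
    Γ.run (Function.update σ i ((σ i).override L a b)) h t z d n = Γ.run σ h t z d n := by
  induction n with
  | zero => rfl
  | succ n ih =>
    have : (Γ.run σ h t z d n).1.length ≠ L := by rw [length_run]; omega
    rw [run, run, ih, Γ.move_override_of_ne σ a b this]

variable [Nonempty N]

lemma stateAt_override (σ : Profile N S) {i : N} {L : ℕ} (a : S i) (b : Bool)
    {ν : Node N S} {ω : Sample N} (hL : L < (Γ.start σ ω ν).history.length)
    (h : Γ.start (Function.update σ i ((σ i).override L a b)) ω ν = Γ.start σ ω ν) (n : ℕ) :
    Γ.stateAt (Function.update σ i ((σ i).override L a b)) ν ω n = Γ.stateAt σ ν ω n := by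
  simp only [stateAt, play_eq, h, Γ.run_override σ a b hL]

lemma stateAt_zero (σ : Profile N S) (ν : Node N S) (ω : Sample N) :
    Γ.stateAt σ ν ω 0 = Γ.state (Γ.start σ ω ν).history := rfl

variable [Fintype N] [∀ i, Finite (S i)]

/-- In an equilibrium, a decision that lowers the flow payoff by `Δ` until the next ring is taken
with probability `0`, provided that the next ring is not expected too early. -/
lemma IsSPNE.volume_eq_zero {Γ : RevisionGame N S} {σ : Profile N S} (hσ : Γ.IsSPNE σ) {i : N}
    {M Δ : ℝ} (hM₀ : 0 ≤ M) (hΔ : 0 < Δ) (hM : ∀ y, |Γ.payoff i y| ≤ M)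
    (hsmall : (Δ + 2 * M) * (Fintype.card (Clock N) * (Γ.rate / Γ.discountRate)) < Δ)
    {ν : Node N S} (hν : Γ.IsNode ν) (ρ : Strategy N S i)
    {B : Set (unitInterval × unitInterval)} (hB : MeasurableSet B)
    (h1 : ∀ ω : Sample N, ω.2 0 ∈ B → Γ.payoff i (Γ.stateAt σ ν ω 0) + Δ ≤
      Γ.payoff i (Γ.stateAt (Function.update σ i ρ) ν ω 0))
    (h2 : ∀ᵐ ω ∂(sampleLaw N Γ.rate), ω.2 0 ∉ B → ∀ n,
      Γ.stateAt (Function.update σ i ρ) ν ω n = Γ.stateAt σ ν ω n) :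
    volume B = 0 := by
  have hprob := isProbabilityMeasure_sampleLaw (N := N) Γ.rate_pos
  have hprob' := isProbabilityMeasure_waitsLaw (N := N) Γ.rate_pos
  set r := Γ.discountRate with hr
  have hr0 : 0 < r := Γ.discountRate_pos
  set e : (Clock N → ℕ → ℝ) → ℝ := fun W => Real.exp (-(r * (nextRing W).2)) with he
  have hei : Integrable e (waitsLaw N Γ.rate) := integrable_exp_wait Γ.rate_pos hr0
  set g : (ℕ → unitInterval × unitInterval) → ℝ := fun d => B.indicator 1 (d 0) with hg
  have hgm : Measurable g :=
    ((measurable_one (α := ℝ)).indicator hB).comp (measurable_pi_apply 0)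
  have hgi : Integrable g drawsLaw := by
    refine Integrable.mono' (integrable_const (1 : ℝ)) hgm.aestronglyMeasurable
      (Filter.Eventually.of_forall fun d => ?_)
    simp only [g, Set.indicator]
    split_ifs <;> simp
  have hgv : ∫ d, g d ∂drawsLaw = volume.real B := by
    have hp := measurePreserving_eval_infinitePi
      (fun _ : ℕ => (volume : Measure (unitInterval × unitInterval))) 0
    rw [← integral_indicator_one hB]
    rw [← hp.map_eq, integral_map hp.measurable.aemeasurable]
    exact ((measurable_one (α := ℝ)).indicator hB).aestronglyMeasurable
  -- Lower bound for the gain from the deviation when the draw lies in `B`. It depends on the waits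
  -- only and `B` on the draws only, so the expectation of `f * g` is a product, and `∫ f > 0`
  -- forces `B` to be null.
  set f : (Clock N → ℕ → ℝ) → ℝ := fun W => (Δ - (Δ + 2 * M) * e W) / r with hf
  have hfi : Integrable f (waitsLaw N Γ.rate) :=
    ((integrable_const Δ).sub (hei.const_mul _)).div_const _
  have hle : ∀ᵐ ω ∂(sampleLaw N Γ.rate), f ω.1 * g ω.2 ≤
      Γ.pathValue (Function.update σ i ρ) ν i ω - Γ.pathValue σ ν i ω := by
    filter_upwards [ae_sampleLaw_fst Γ.rate_pos (ae_iterate_advance_pos Γ.rate_pos), h2]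
      with ω hω h2
    by_cases hωB : ω.2 0 ∈ B
    · have h := Γ.pathValue_sub_le (σ := Function.update σ i ρ) (σ' := σ) hM hω (n := 0)
        (by simp) (h1 ω hωB)
      simp only [ringTime_zero, mul_zero, neg_zero, Real.exp_zero, Function.iterate_zero,
        id] at h
      simp only [f, g, Set.indicator_of_mem hωB, Pi.one_apply, mul_one, e]
      have h' : (Δ - (Δ + 2 * M) * Real.exp (-(r * (nextRing ω.1).2))) / r =
        -(1 / r * (-Δ + (Δ + 2 * M) * Real.exp (-(r * (nextRing ω.1).2)))) := by
        field_simp; ring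
      rw [h']
      linarith
    · simp only [g, Set.indicator_of_notMem hωB, mul_zero]
      rw [Γ.pathValue_congr (h2 hωB), sub_self]
  have hint := integral_mono_ae (by rw [sampleLaw_eq]; exact hfi.mul_prod hgi)
    ((Γ.integrable_pathValue hM _ ν _).sub (Γ.integrable_pathValue hM _ ν _)) hle
  rw [integral_sub' (Γ.integrable_pathValue hM _ ν _) (Γ.integrable_pathValue hM _ ν _)] at hint
  have hval : Γ.value (Function.update σ i ρ) ν i ≤ Γ.value σ ν i := hσ ν hν i ρ
  have hval' : ∫ ω, Γ.pathValue (Function.update σ i ρ) ν i ω ∂(sampleLaw N Γ.rate) ≤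
    ∫ ω, Γ.pathValue σ ν i ω ∂(sampleLaw N Γ.rate) := hval
  rw [sampleLaw_eq, integral_prod_mul, hgv] at hint
  rw [sampleLaw_eq] at hval'
  have hfpos : 0 < ∫ W, f W ∂(waitsLaw N Γ.rate) := by
    rw [hf, integral_div, integral_sub (integrable_const Δ) (hei.const_mul _),
      integral_const_mul, integral_const, probReal_univ, one_smul]
    refine div_pos ?_ hr0
    have := integral_exp_wait_le (N := N) Γ.rate_pos hr0
    have : (Δ + 2 * M) * ∫ W, e W ∂(waitsLaw N Γ.rate) ≤
      (Δ + 2 * M) * (Fintype.card (Clock N) * (Γ.rate / r)) :=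
      mul_le_mul_of_nonneg_left this (by positivity)
    linarith
  have hv : volume.real B ≤ 0 := by
    by_contra hv
    have := mul_pos hfpos (not_le.1 hv)
    linarith
  exact (measureReal_eq_zero_iff).1 (le_antisymm hv measureReal_nonneg)

end RevisionGame

end Override

/-! ### Payoff gaps and consequences of genericity -/

section

variable {N : Type v} {S : N → Type w}

lemma Outcome.addLink_comm (x : Outcome N S) (i j : N) : x.addLink i j = x.addLink j i := by
  simp [Outcome.addLink, SimpleGraph.edge_comm]

lemma Outcome.addLink_deleteLink {x : Outcome N S} {i j : N} (h : x.1.Adj i j) :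
    (x.deleteLink i j).addLink i j = x := by
  refine Prod.ext ?_ rfl
  exact sdiff_sup_cancel ((SimpleGraph.edge_le_iff _).2 (Or.inr h))

lemma Outcome.not_adj_deleteLink (x : Outcome N S) {i j : N} (hij : i ≠ j) :
    ¬ (x.deleteLink i j).1.Adj i j := by
  simp [Outcome.deleteLink, SimpleGraph.edge_adj, hij]

/-- The gaps between different payoffs of a player are bounded below, if there are finitely many
outcomes. -/
lemma exists_payoff_gap [Finite N] [∀ i, Finite (S i)] (u : N → Outcome N S → ℝ) :
    ∃ Δ > 0, ∀ i y y', u i y < u i y' → u i y + Δ ≤ u i y' := by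
  have : ∀ p : N × Outcome N S × Outcome N S, ∃ Δ > 0,
      u p.1 p.2.1 < u p.1 p.2.2 → u p.1 p.2.1 + Δ ≤ u p.1 p.2.2 := fun p => by
    by_cases h : u p.1 p.2.1 < u p.1 p.2.2
    · exact ⟨u p.1 p.2.2 - u p.1 p.2.1, sub_pos.2 h, fun _ => by linarith⟩
    · exact ⟨1, one_pos, fun h' => absurd h' h⟩
  choose D hD0 hD using this
  cases isEmpty_or_nonempty (N × Outcome N S × Outcome N S) with
  | inl he => exact ⟨1, one_pos, fun i y y' => (he.false (i, y, y')).elim⟩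
  | inr hne =>
    obtain ⟨p, hp⟩ := Finite.exists_min D
    exact ⟨D p, hD0 p, fun i y y' h =>
      le_trans (by linarith [hp (i, y, y')]) (hD (i, y, y') h)⟩

lemma exists_payoff_bound [Finite N] [∀ i, Finite (S i)] (u : N → Outcome N S → ℝ) :
    ∃ M ≥ 0, ∀ i y, |u i y| ≤ M := by
  cases isEmpty_or_nonempty (N × Outcome N S) with
  | inl he => exact ⟨0, le_rfl, fun i y => (he.false (i, y)).elim⟩
  | inr hne =>
    obtain ⟨p, hp⟩ := Finite.exists_max fun p : N × Outcome N S => |u p.1 p.2|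
    exact ⟨_, abs_nonneg _, fun i y => hp (i, y)⟩

variable [DecidableEq N] {u : N → Outcome N S → ℝ}

/-- A deletion is an addition read backwards, from the graph without the link. -/
lemma GenericPayoffs.deleteLink_ne (hu : GenericPayoffs u) {i j : N} {x : Outcome N S}
    (h : x.1.Adj i j) : u i (x.deleteLink i j) ≠ u i x := by
  have := hu.2 i j (x.deleteLink i j) h.ne (x.not_adj_deleteLink h.ne)
  rw [Outcome.addLink_deleteLink h] at this
  exact this.symm

/-- The unique myopically optimal action. -/
def GenericPayoffs.bestAction (hu : GenericPayoffs u) (i : N) (x : Outcome N S) : S i :=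
  (hu.1 i x).choose

lemma GenericPayoffs.lt_bestAction (hu : GenericPayoffs u) (i : N) (x : Outcome N S) {b : S i}
    (hb : b ≠ hu.bestAction i x) :
    u i (x.setAction i b) < u i (x.setAction i (hu.bestAction i x)) := by
  obtain ⟨h1, h2⟩ := (hu.1 i x).choose_spec
  refine lt_of_le_of_ne (h1 b) fun h => hb (h2 b fun c => ?_)
  rw [h]
  exact h1 c

end

/-! ### An outcome that persists in equilibrium is pairwise stable -/

namespace RevisionGame

variable {N : Type v} {S : N → Type w} [DecidableEq N] (Γ : RevisionGame N S)

/-- Equilibrium restricts behaviour at possible nodes only; this shows that the path of play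
consists of such nodes. -/
lemma feasible_run (σ : Profile N S) {z : ℕ → Clock N × ℝ} (hz : ∀ k, 0 < (z k).2)
    (d : ℕ → unitInterval × unitInterval) (n : ℕ) :
    Γ.Feasible (Γ.run σ [] 0 z d n).1 ∧
      History.lastTime (Γ.run σ [] 0 z d n).1 = (Γ.run σ [] 0 z d n).2 := by
  induction n with
  | zero => exact ⟨trivial, rfl⟩
  | succ n ih =>
    refine ⟨⟨ih.1, by rw [ih.2]; exact lt_add_of_pos_right _ (hz n), ?_⟩, rfl⟩
    rcases (z n).1 with i | ⟨⟨i, j⟩, hij⟩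
    · trivial
    · simp only [move, answer]
      split_ifs with h1 h2 h3
      · exact h2
      · exact ⟨hij, h2⟩
      · exact ⟨hij, h2⟩
      · exact hij

variable [Nonempty N] [Fintype N] [∀ i, Finite (S i)]

section Equilibrium

variable {Γ} {σ : Profile N S} (hσ : Γ.IsSPNE σ) {M Δ : ℝ} (hM₀ : 0 ≤ M) (hΔ : 0 < Δ)
  (hM : ∀ i y, |Γ.payoff i y| ≤ M)
  (hgap : ∀ i y y', Γ.payoff i y < Γ.payoff i y' → Γ.payoff i y + Δ ≤ Γ.payoff i y')
  (hsmall : (Δ + 2 * M) * (Fintype.card (Clock N) * (Γ.rate / Γ.discountRate)) < Δ)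
  {h : History N S} (hh : Γ.Feasible h) {t : ℝ} (ht : History.lastTime h < t)

include hσ hM₀ hΔ hM hgap hsmall hh ht

lemma volume_act_ne {i : N} {a : S i}
    (ha : ∀ b, b ≠ a → Γ.payoff i ((Γ.state h).setAction i b) <
      Γ.payoff i ((Γ.state h).setAction i a)) :
    volume {r : unitInterval × unitInterval | (σ i).act h t r.1 ≠ a} = 0 := by
  have hact := (σ i).measurable_act.comp
    (measurableHistory_const (Ω := unitInterval × unitInterval) h)
    (measurable_const (a := t)) measurable_fst
  refine hσ.volume_eq_zero hM₀ hΔ (hM i) hsmall (ν := .ring h t (.inl i)) ⟨hh, ht⟩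
    ((σ i).override h.length a true) (@hact {b | b ≠ a} trivial) (fun ω hω => ?_)
    (Filter.Eventually.of_forall fun ω hω n => ?_)
  · refine hgap _ _ _ ?_
    simp only [stateAt_zero, start, state, move, Function.update_self, Strategy.override, if_true,
      Move.apply]
    exact ha _ hω
  · refine Γ.stateAt_override σ a true (by simp [start]) ?_ n
    have hω' : (σ i).act h t (ω.2 0).1 = a := not_not.1 hω
    simp [start, move, Strategy.override, hω']

lemma volume_not_link_of_adj {i j : N} (hij : (Γ.state h).1.Adj i j)
    (hlt : Γ.payoff i (Γ.state h) < Γ.payoff i ((Γ.state h).deleteLink i j)) :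
    volume {r : unitInterval × unitInterval | (σ i).link j h t r.1 ≠ true} = 0 := by
  have hl := ((σ i).measurable_link j).comp
    (measurableHistory_const (Ω := unitInterval × unitInterval) h)
    (measurable_const (a := t)) measurable_fst
  refine hσ.volume_eq_zero hM₀ hΔ (hM i) hsmall (ν := .ring h t (.inr ⟨(i, j), hij.ne⟩)) ⟨hh, ht⟩
    -- No action is chosen at this node nor later at a history of this length, so any element of `S
    -- i` serves as the overriding action.
    ((σ i).override h.length (Γ.initial.2 i) true) (@hl {b | b ≠ true} trivial) (fun ω hω => ?_)
    (Filter.Eventually.of_forall fun ω hω n => ?_)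
  · refine hgap _ _ _ ?_
    have hω' : (σ i).link j h t (ω.2 0).1 ≠ true := hω
    simpa [stateAt_zero, start, state, move, Strategy.override, Move.apply, hij, hω'] using hlt
  · refine Γ.stateAt_override σ _ true (by simp [start]) ?_ n
    have hω' : (σ i).link j h t (ω.2 0).1 = true := not_not.1 hω
    simp [start, move, Strategy.override, hω', hij]

lemma volume_not_respond {i j : N} (hne : i ≠ j) (hij : ¬ (Γ.state h).1.Adj i j)
    (hlt : Γ.payoff j (Γ.state h) < Γ.payoff j ((Γ.state h).addLink i j)) :
    volume {r : unitInterval × unitInterval | (σ j).respond i h t r.2 ≠ true} = 0 := by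
  have hl := ((σ j).measurable_respond i).comp
    (measurableHistory_const (Ω := unitInterval × unitInterval) h)
    (measurable_const (a := t)) measurable_snd
  refine hσ.volume_eq_zero hM₀ hΔ (hM j) hsmall (ν := .proposal h t i j) ⟨hh, ht, hne, hij⟩
    ((σ j).override h.length (Γ.initial.2 j) true) (@hl {b | b ≠ true} trivial) (fun ω hω => ?_)
    (Filter.Eventually.of_forall fun ω hω n => ?_)
  · refine hgap _ _ _ ?_
    have hω' : (σ j).respond i h t (ω.2 0).2 ≠ true := hω
    simpa [stateAt_zero, start, state, answer, Strategy.override, Move.apply, hω'] using hlt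
  · refine Γ.stateAt_override σ _ true (by simp [start]) ?_ n
    have hω' : (σ j).respond i h t (ω.2 0).2 = true := not_not.1 hω
    simp [start, answer, Strategy.override, hω']

/-- Backward induction within one instant: the myopic gain of `i` from proposing exists only if `j`
accepts, and `j` almost surely accepts because she gains too. -/
lemma volume_not_link {i j : N} (hne : i ≠ j) (hij : ¬ (Γ.state h).1.Adj i j)
    (hlt : Γ.payoff i (Γ.state h) < Γ.payoff i ((Γ.state h).addLink i j))
    (hlt' : Γ.payoff j (Γ.state h) < Γ.payoff j ((Γ.state h).addLink i j)) :
    volume {r : unitInterval × unitInterval | (σ i).link j h t r.1 ≠ true} = 0 := by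
  have hrv := volume_not_respond hσ hM₀ hΔ hM hgap hsmall hh ht hne hij hlt'
  have hl := ((σ i).measurable_link j).comp
    (measurableHistory_const (Ω := unitInterval × unitInterval) h)
    (measurable_const (a := t)) measurable_fst
  have hr := ((σ j).measurable_respond i).comp
    (measurableHistory_const (Ω := unitInterval × unitInterval) h)
    (measurable_const (a := t)) measurable_snd
  -- Equilibrium bounds only the event that `i` abstains although `j` would accept. Outside it, and
  -- outside the null event of a rejection, `i` already proposes, so the correction changes nothing.
  have hB : volume ({r : unitInterval × unitInterval | (σ i).link j h t r.1 ≠ true} ∩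
      {r | (σ j).respond i h t r.2 = true}) = 0 := by
    refine hσ.volume_eq_zero hM₀ hΔ (hM i) hsmall (ν := .ring h t (.inr ⟨(i, j), hne⟩))
      ⟨hh, ht⟩ ((σ i).override h.length (Γ.initial.2 i) true)
      (MeasurableSet.inter (@hl {b | b ≠ true} trivial) (@hr {b | b = true} trivial))
      (fun ω hω => ?_) ?_
    · refine hgap _ _ _ ?_
      have hω1 : (σ i).link j h t (ω.2 0).1 ≠ true := hω.1
      have hω2 : (σ j).respond i h t (ω.2 0).2 = true := hω.2
      simpa [stateAt_zero, start, state, move, answer, Strategy.override, Move.apply, hij, hω1,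
        hω2, Function.update_of_ne hne.symm] using hlt
    · filter_upwards [ae_sampleLaw_draw Γ.rate_pos hrv 0] with ω hωr hω n
      refine Γ.stateAt_override σ _ true (by simp [start]) ?_ n
      have hω2 : (σ j).respond i h t (ω.2 0).2 = true := not_not.1 hωr
      have hω1 : (σ i).link j h t (ω.2 0).1 = true := by
        by_contra hcon
        exact hω ⟨hcon, hω2⟩
      simp [start, move, answer, Strategy.override, hω1, hω2, hij, Function.update_of_ne hne.symm]
  refine measure_mono_null (fun r hr1 => ?_) (measure_union_null hB hrv)
  by_cases h2 : (σ j).respond i h t r.2 = true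
  · exact Or.inl ⟨hr1, h2⟩
  · exact Or.inr h2

end Equilibrium

/-- At an outcome that is not pairwise stable, some clock makes the players move away from it. -/
lemma exists_clock_leaving {σ : Profile N S} {Γ : RevisionGame N S} (hσ : Γ.IsSPNE σ) {M Δ : ℝ}
    (hM₀ : 0 ≤ M) (hΔ : 0 < Δ) (hM : ∀ i y, |Γ.payoff i y| ≤ M)
    (hgap : ∀ i y y', Γ.payoff i y < Γ.payoff i y' → Γ.payoff i y + Δ ≤ Γ.payoff i y')
    (hsmall : (Δ + 2 * M) * (Fintype.card (Clock N) * (Γ.rate / Γ.discountRate)) < Δ)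
    (hu : GenericPayoffs Γ.payoff) {x : Outcome N S} (hx : ¬ PairwiseStable Γ.payoff x) :
    ∃ c : Clock N, ∀ h, Γ.Feasible h → Γ.state h = x → ∀ t, History.lastTime h < t →
      volume {r | (Γ.move σ h t c r).apply x = x} = 0 := by
  have hne : ∀ {i : N} {y : Outcome N S}, Γ.payoff i x < Γ.payoff i y → y ≠ x := by
    rintro i y h rfl; exact lt_irrefl _ h
  rw [PairwiseStable, not_and_or, not_and_or] at hx
  push Not at hx
  rcases hx with ⟨i, a, hia⟩ | ⟨i, j, hij, hlt⟩ | ⟨i, j, hij, hadj, h1, h2, -⟩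
  · refine ⟨.inl i, ?_⟩
    rintro h hh rfl t ht
    have hbest : ∀ b, b ≠ hu.bestAction i (Γ.state h) → _ := fun b hb => hu.lt_bestAction i _ hb
    refine measure_mono_null (fun r hr => ?_)
      (volume_act_ne hσ hM₀ hΔ hM hgap hsmall hh ht hbest)
    intro hr'
    have hr2 : (Γ.state h).setAction i ((σ i).act h t r.1) = Γ.state h := hr
    rw [hr'] at hr2
    refine hne (i := i) ?_ hr2
    -- Only the improvement by `a` is given; the best action improves at least as much, so taking it
    -- cannot leave the outcome unchanged.
    by_cases ha : a = hu.bestAction i (Γ.state h)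
    · rw [← ha]; exact hia
    · exact hia.trans (hbest a ha)
  · refine ⟨.inr ⟨(i, j), hij.ne⟩, ?_⟩
    rintro h hh rfl t ht
    refine measure_mono_null (fun r hr => ?_)
      (volume_not_link_of_adj hσ hM₀ hΔ hM hgap hsmall hh ht hij hlt)
    intro hr'
    have hr2 : (Γ.move σ h t (.inr ⟨(i, j), hij.ne⟩) r).apply (Γ.state h) = Γ.state h := hr
    simp only [move, hr', if_true, if_pos hij, Move.apply] at hr2
    exact hne hlt hr2
  · refine ⟨.inr ⟨(i, j), hij⟩, ?_⟩
    rintro h hh rfl t ht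
    -- Genericity turns both weak inequalities of the blocking pair into strict ones, so that both
    -- the proposal and its acceptance are forced.
    have h1' := lt_of_le_of_ne h1 (hu.2 i j _ hij hadj).symm
    have h2' : Γ.payoff j (Γ.state h) < Γ.payoff j ((Γ.state h).addLink i j) := by
      refine lt_of_le_of_ne h2 ?_
      rw [Outcome.addLink_comm]
      exact (hu.2 j i _ hij.symm fun h => hadj h.symm).symm
    refine measure_mono_null (fun r hr => ?_) (measure_union_null
      (volume_not_link hσ hM₀ hΔ hM hgap hsmall hh ht hij hadj h1' h2')
      (volume_not_respond hσ hM₀ hΔ hM hgap hsmall hh ht hij hadj h2'))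
    by_contra hcon
    simp only [Set.mem_union, Set.mem_ofPred_eq, not_or, not_not] at hcon
    have hr2 : (Γ.move σ h t (.inr ⟨(i, j), hij⟩) r).apply (Γ.state h) = Γ.state h := hr
    simp only [move, answer, hcon.1, hcon.2, if_true, if_neg hadj, Move.apply] at hr2
    exact hne h1' hr2

omit [Fintype N] [∀ i, Finite (S i)] in
lemma stateAt_waiting (σ : Profile N S) (ω : Sample N) (n : ℕ) :
    Γ.stateAt σ (.waiting [] 0) ω n = Γ.state (Γ.run σ [] 0 (rings ω.1) ω.2 n).1 := by
  rw [stateAt, play_eq]; rfl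

lemma measurable_stateAt_waiting (σ : Profile N S) (n : ℕ) :
    Measurable fun ω : Sample N => Γ.stateAt σ (.waiting [] 0) ω n := by
  simp only [stateAt_waiting]
  exact measurable_state Γ (Γ.measurable_run σ (measurableHistory_const (Ω := Sample N) []) 0
    (z := fun ω => rings ω.1) (by fun_prop) (by fun_prop) n).1

/-- A move that has probability `0` at every history is almost surely not made on the path. -/
lemma ae_leaves {σ : Profile N S} {x : Outcome N S} {c : Clock N}
    (hc : ∀ h, Γ.Feasible h → Γ.state h = x → ∀ t, History.lastTime h < t →
      volume {r | (Γ.move σ h t c r).apply x = x} = 0) :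
    ∀ᵐ ω ∂(sampleLaw N Γ.rate), ∀ n, Γ.stateAt σ (.waiting [] 0) ω n = x →
      nextClock (advance^[n] ω.1) = c → Γ.stateAt σ (.waiting [] 0) ω (n + 1) ≠ x := by
  have hprob := isProbabilityMeasure_waitsLaw (N := N) Γ.rate_pos
  refine ae_all_iff.2 fun n => ?_
  set A : Set (Sample N) := {ω | Γ.stateAt σ (.waiting [] 0) ω n = x ∧
    nextClock (advance^[n] ω.1) = c ∧ Γ.stateAt σ (.waiting [] 0) ω (n + 1) = x} with hA
  have hAm : MeasurableSet A := by
    refine (Γ.measurable_stateAt_waiting σ n (measurableSet_singleton x)).inter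
      (MeasurableSet.inter ?_
        (Γ.measurable_stateAt_waiting σ (n + 1) (measurableSet_singleton x)))
    exact (measurable_nextClock.comp ((measurable_advance.iterate n).comp measurable_fst))
      (measurableSet_singleton c)
  have h0 : sampleLaw N Γ.rate A = 0 := by
    rw [sampleLaw_eq, Measure.measure_prod_null hAm]
    filter_upwards [ae_iterate_advance_pos Γ.rate_pos] with W hW
    -- Draw `n` is resampled with everything else fixed. The history after `n` rings uses earlier
    -- draws only, so `hc` applies to it and gives the new draw probability zero of staying at `x`.
    have hu := measurePreserving_update_infinitePi
      (volume : Measure (unitInterval × unitInterval)) n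
    have hAW : MeasurableSet (Prod.mk W ⁻¹' A) := measurable_prodMk_left hAm
    rw [Pi.zero_apply, ← hu.measure_preimage hAW.nullMeasurableSet,
      Measure.measure_prod_null (hu.measurable hAW)]
    refine Filter.Eventually.of_forall fun d => ?_
    rw [Pi.zero_apply]
    have hz : ∀ k, 0 < (rings W k).2 := fun k => hW k _ 0
    obtain ⟨hf, hl⟩ := Γ.feasible_run σ hz d n
    set R := Γ.run σ [] 0 (rings W) d n with hR
    have hrun : ∀ r, Γ.run σ [] 0 (rings W) (Function.update d n r) n = R := fun r =>
      Γ.run_congr σ [] 0 (fun _ _ => rfl) fun k hk => Function.update_of_ne hk.ne _ _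
    by_cases hx : Γ.state R.1 = x
    · refine measure_mono_null (fun r hr => ?_)
        (hc R.1 hf hx (R.2 + (rings W n).2) (by rw [hl]; exact lt_add_of_pos_right _ (hz n)))
      obtain ⟨-, h2, h3⟩ : Γ.stateAt σ (.waiting [] 0) (W, Function.update d n r) n = x ∧
        nextClock (advance^[n] W) = c ∧
        Γ.stateAt σ (.waiting [] 0) (W, Function.update d n r) (n + 1) = x := hr
      rw [stateAt_waiting, run, hrun, state, hx] at h3
      simp only [Function.update_self] at h3
      change (Γ.move σ R.1 (R.2 + (rings W n).2) (nextClock (advance^[n] W)) r).apply x = x at h3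
      rw [h2] at h3
      exact h3
    · convert measure_empty
      · ext r
        simp only [Set.mem_preimage, Set.mem_empty_iff_false, iff_false]
        rintro ⟨h1, -⟩
        rw [stateAt_waiting, hrun] at h1
        exact hx h1
      · infer_instance
  filter_upwards [measure_eq_zero_iff_ae_notMem.1 h0] with ω hω h1 h2 h3
  exact hω ⟨h1, h2, h3⟩

omit [Fintype N] [∀ i, Finite (S i)] in
lemma onPath_ringTime (σ : Profile N S) {ω : Sample N}
    (hW : ∀ n c k, 0 < advance^[n] ω.1 c k) (n : ℕ) :
    Γ.onPath σ ω (ringTime ω.1 n) = Γ.stateAt σ (.waiting [] 0) ω n := by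
  refine Γ.outcomeAt_start_of_mem (ν := .waiting [] 0) hW ?_ ?_
  · simp [Node.time]
  · simpa [Node.time] using ringTime_strictMono hW (Nat.lt_succ_self n)

/-- An outcome that is played forever from some time on in an equilibrium is pairwise stable. -/
theorem pairwiseStable_of_absorbing {σ : Profile N S} {Γ : RevisionGame N S} (hσ : Γ.IsSPNE σ)
    {M Δ : ℝ} (hM₀ : 0 ≤ M) (hΔ : 0 < Δ) (hM : ∀ i y, |Γ.payoff i y| ≤ M)
    (hgap : ∀ i y y', Γ.payoff i y < Γ.payoff i y' → Γ.payoff i y + Δ ≤ Γ.payoff i y')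
    (hsmall : (Δ + 2 * M) * (Fintype.card (Clock N) * (Γ.rate / Γ.discountRate)) < Δ)
    (hu : GenericPayoffs Γ.payoff) {x : Outcome N S}
    (habs : ∀ᵐ ω ∂(sampleLaw N Γ.rate), ∃ s : ℝ, ∀ t, s ≤ t → 0 ≤ t → Γ.onPath σ ω t = x) :
    PairwiseStable Γ.payoff x := by
  by_contra hx
  obtain ⟨c, hc⟩ := exists_clock_leaving hσ hM₀ hΔ hM hgap hsmall hu hx
  have hprob := isProbabilityMeasure_sampleLaw (N := N) Γ.rate_pos
  obtain ⟨ω, hW, hfreq, hleave, s, hs⟩ :=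
    ((ae_sampleLaw_fst Γ.rate_pos (ae_iterate_advance_pos Γ.rate_pos)).and
      ((ae_sampleLaw_fst Γ.rate_pos (ae_frequently_one_lt Γ.rate_pos)).and
        ((Γ.ae_leaves hc).and habs))).exists
  -- Past the date `s` the outcome is `x` after every ring, yet a ring of `c` past this date moves
  -- play away from `x`.
  obtain ⟨n, hn⟩ := exists_lt_ringTime (W := ω.1) (hW 0) hfreq s
  obtain ⟨m, hmn, hm⟩ := exists_nextClock_eq hW hfreq c n
  have hmono := (ringTime_strictMono hW).monotone
  have hx' : ∀ k ≥ m, Γ.stateAt σ (.waiting [] 0) ω k = x := fun k hk => by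
    rw [← Γ.onPath_ringTime σ hW]
    refine hs _ (hn.le.trans (hmono (hmn.trans hk))) ?_
    rw [← ringTime_zero ω.1]
    exact hmono (Nat.zero_le k)
  exact hleave m (hx' m le_rfl) hm (hx' (m + 1) (Nat.le_succ m))

end RevisionGame

/-! ### The myopic profile -/

namespace RevisionGame

variable {N : Type v} {S : N → Type w} [DecidableEq N] (Γ : RevisionGame N S)

lemma measurableRule_state {D : Type*} (F : Outcome N S → D) :
    MeasurableRule fun (h : History N S) (_ : ℝ) (_ : unitInterval) => F (Γ.state h) := by
  intro n m
  have : (fun p : (Fin n → ℝ) × ℝ × unitInterval =>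
      F (Γ.state (List.ofFn fun k => (p.1 k, m k)))) =
      fun _ => F (Γ.state (List.ofFn fun k => (0, m k))) := by
    funext p
    congr 1
    refine Γ.state_congr Γ rfl ?_
    rw [List.map_ofFn, List.map_ofFn]
    rfl
  simp only [this]
  exact @measurable_const _ _ ⊤ _ _

variable {Γ} (hu : GenericPayoffs Γ.payoff)

open Classical in
/-- All players choose at every date what maximizes their flow payoff until the next ring. -/
def myopicProfile : Profile N S := fun i =>
  { act := fun h _ _ => hu.bestAction i (Γ.state h)
    link := fun j h _ _ => decide (Γ.payoff i (Γ.state h) <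
      if (Γ.state h).1.Adj i j then Γ.payoff i ((Γ.state h).deleteLink i j)
      else Γ.payoff i ((Γ.state h).addLink i j))
    respond := fun j h _ _ => decide (Γ.payoff i (Γ.state h) <
      Γ.payoff i ((Γ.state h).addLink j i))
    measurable_act := Γ.measurableRule_state _
    measurable_link := fun j => Γ.measurableRule_state fun y => decide (Γ.payoff i y <
      if y.1.Adj i j then Γ.payoff i (y.deleteLink i j) else Γ.payoff i (y.addLink i j))
    measurable_respond := fun j => Γ.measurableRule_state fun y => decide (Γ.payoff i y <
      Γ.payoff i (y.addLink j i)) }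

lemma myopicProfile_isPure (i : N) : (myopicProfile hu i).IsPure :=
  fun _ _ _ _ => ⟨rfl, fun _ => rfl, fun _ => rfl⟩

lemma move_of_adj (σ : Profile N S) {h : History N S} {k j : N} (hkj : k ≠ j)
    (hadj : (Γ.state h).1.Adj k j) (t : ℝ) (r : unitInterval × unitInterval) :
    Γ.move σ h t (.inr ⟨(k, j), hkj⟩) r =
      if (σ k).link j h t r.1 then .delete k j else .pass k j := by
  simp only [move, if_pos hadj]

lemma move_of_not_adj (σ : Profile N S) {h : History N S} {k j : N} (hkj : k ≠ j)
    (hadj : ¬ (Γ.state h).1.Adj k j) (t : ℝ) (r : unitInterval × unitInterval) :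
    Γ.move σ h t (.inr ⟨(k, j), hkj⟩) r =
      if (σ k).link j h t r.1 then answer σ h t k j r.2 else .pass k j := by
  simp only [move, if_neg hadj]

lemma myopic_link_of_adj {h : History N S} {k j : N} (hadj : (Γ.state h).1.Adj k j) (t : ℝ)
    (r : unitInterval) : (myopicProfile hu k).link j h t r = true ↔
      Γ.payoff k (Γ.state h) < Γ.payoff k ((Γ.state h).deleteLink k j) := by
  simp only [myopicProfile, if_pos hadj, decide_eq_true_eq]

lemma myopic_link_of_not_adj {h : History N S} {k j : N} (hadj : ¬ (Γ.state h).1.Adj k j) (t : ℝ)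
    (r : unitInterval) : (myopicProfile hu k).link j h t r = true ↔
      Γ.payoff k (Γ.state h) < Γ.payoff k ((Γ.state h).addLink k j) := by
  simp only [myopicProfile, if_neg hadj, decide_eq_true_eq]

lemma myopic_respond {h : History N S} {k j : N} (t : ℝ) (r : unitInterval) :
    (myopicProfile hu j).respond k h t r = true ↔
      Γ.payoff j (Γ.state h) < Γ.payoff j ((Γ.state h).addLink k j) := by
  simp only [myopicProfile, decide_eq_true_eq]

lemma answer_apply (σ : Profile N S) (h : History N S) (y : Outcome N S) (t : ℝ) (k j : N)
    (r : unitInterval) : (answer σ h t k j r).apply y =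
      if (σ j).respond k h t r = true then y.addLink k j else y := by
  rw [answer]; split_ifs <;> rfl

/-- The histories may differ, but the others react to the current outcome only, so equality of
outcomes suffices. If the deviator herself answers, genericity makes a different answer strictly
worse. -/
lemma answer_myopic (i : N) (ρ : Strategy N S i) {h h' : History N S}
    (hh : Γ.state h' = Γ.state h) {k j : N} (hkj : k ≠ j)
    (hadj : ¬ (Γ.state h).1.Adj k j) (t : ℝ) (r : unitInterval) :
    (answer (Function.update (myopicProfile hu) i ρ) h' t k j r).apply (Γ.state h') =
      (answer (myopicProfile hu) h t k j r).apply (Γ.state h) ∨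
    Γ.payoff i ((answer (Function.update (myopicProfile hu) i ρ) h' t k j r).apply (Γ.state h')) <
      Γ.payoff i ((answer (myopicProfile hu) h t k j r).apply (Γ.state h)) := by
  simp only [answer_apply, myopic_respond]
  by_cases hj : j = i
  · subst hj
    have hne := hu.2 j k (Γ.state h) hkj.symm fun h => hadj h.symm
    rw [Outcome.addLink_comm] at hne
    simp only [Function.update_self, hh]
    split_ifs with h1 h2 h2
    · exact Or.inl rfl
    · exact Or.inr (lt_of_le_of_ne (not_lt.1 h2) hne)
    · exact Or.inr h2
    · exact Or.inl rfl
  · simp only [Function.update_of_ne hj, myopic_respond, hh]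
    exact Or.inl trivial

/-- The deviator may own the clock or be the one who answers. Either way her decision has no effect
on the outcome or, by genericity, is strictly worse than the myopic one until the next ring. -/
lemma move_myopic (i : N) (ρ : Strategy N S i) {h h' : History N S}
    (hh : Γ.state h' = Γ.state h) (t : ℝ) (c : Clock N) (r : unitInterval × unitInterval) :
    (Γ.move (Function.update (myopicProfile hu) i ρ) h' t c r).apply (Γ.state h') =
      (Γ.move (myopicProfile hu) h t c r).apply (Γ.state h) ∨
    Γ.payoff i ((Γ.move (Function.update (myopicProfile hu) i ρ) h' t c r).apply (Γ.state h')) <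
      Γ.payoff i ((Γ.move (myopicProfile hu) h t c r).apply (Γ.state h)) := by
  rcases c with k | ⟨⟨k, j⟩, hkj⟩
  · by_cases hk : k = i
    · subst hk
      simp only [move, Function.update_self, myopicProfile, Move.apply, hh]
      by_cases hb : ρ.act h' t r.1 = hu.bestAction k (Γ.state h)
      · rw [hb]; exact Or.inl rfl
      · exact Or.inr (hu.lt_bestAction k _ hb)
    · simp only [move, Function.update_of_ne hk, myopicProfile, hh]
      exact Or.inl trivial
  · have hkj : k ≠ j := hkj
    by_cases hadj : (Γ.state h).1.Adj k j
    · have hadj' : (Γ.state h').1.Adj k j := hh ▸ hadj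
      rw [move_of_adj _ hkj hadj, move_of_adj _ hkj hadj']
      simp only [myopic_link_of_adj hu hadj]
      by_cases hk : k = i
      · subst hk
        have hne := hu.deleteLink_ne hadj
        simp only [Function.update_self, hh]
        split_ifs with h1 h2 h2
        · exact Or.inl rfl
        · exact Or.inr (lt_of_le_of_ne (not_lt.1 h2) hne)
        · exact Or.inr h2
        · exact Or.inl rfl
      · simp only [Function.update_of_ne hk, myopic_link_of_adj hu hadj', hh]
        exact Or.inl trivial
    · have hadj' : ¬ (Γ.state h').1.Adj k j := hh ▸ hadj
      rw [move_of_not_adj _ hkj hadj, move_of_not_adj _ hkj hadj']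
      simp only [myopic_link_of_not_adj hu hadj]
      by_cases hk : k = i
      · subst hk
        have hne := hu.2 k j _ hkj hadj
        simp only [Function.update_self, hh]
        split_ifs with h1 h2 h2
        · rw [← hh]; exact hh ▸ answer_myopic hu k ρ hh hkj hadj t r.2
        -- The deviator proposes a link that she does not want: acceptance hurts her, and rejection
        -- leaves the outcome as it is.
        · simp only [answer_apply, Function.update_of_ne hkj.symm, myopic_respond, hh]
          split_ifs
          · exact Or.inr (lt_of_le_of_ne (not_lt.1 h2) hne)
          · exact Or.inl rfl
        · simp only [answer_apply, myopic_respond]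
          split_ifs
          · exact Or.inr h2
          · exact Or.inl rfl
        · exact Or.inl rfl
      · simp only [Function.update_of_ne hk, myopic_link_of_not_adj hu hadj', hh]
        split_ifs
        · rw [← hh]; exact hh ▸ answer_myopic hu i ρ hh hkj hadj t r.2
        · exact Or.inl rfl

variable [Nonempty N]

lemma stateAt_eq_run (σ : Profile N S) (ν : Node N S) (ω : Sample N) (n : ℕ) :
    Γ.stateAt σ ν ω n = Γ.state (Γ.run σ (Γ.start σ ω ν).history ν.time (rings ω.1)
      (Γ.start σ ω ν).draws n).1 := by
  rw [stateAt, play_eq, start_time, start_waits]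

/-- The first time that the outcome differs, the deviating player has done herself harm. -/
lemma payoff_lt_of_first_deviation (i : N) (ρ : Strategy N S i) {ν : Node N S} (hν : Γ.IsNode ν)
    {ω : Sample N} {n : ℕ}
    (h1 : ∀ k < n, Γ.stateAt (Function.update (myopicProfile hu) i ρ) ν ω k =
      Γ.stateAt (myopicProfile hu) ν ω k)
    (h2 : Γ.stateAt (Function.update (myopicProfile hu) i ρ) ν ω n ≠
      Γ.stateAt (myopicProfile hu) ν ω n) :
    Γ.payoff i (Γ.stateAt (Function.update (myopicProfile hu) i ρ) ν ω n) <
      Γ.payoff i (Γ.stateAt (myopicProfile hu) ν ω n) := by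
  cases n with
  -- Before any further ring, only the decision pending at the node can make a difference.
  | zero =>
    cases ν with
    | waiting h t => exact absurd rfl h2
    | ring h t c => exact (move_myopic hu i ρ rfl t c (ω.2 0)).resolve_left h2
    | proposal h t k j =>
      obtain ⟨-, -, hkj, hadj⟩ := hν
      exact (answer_myopic hu i ρ rfl hkj hadj t (ω.2 0).2).resolve_left h2
  | succ n =>
    have h3 := h1 n (Nat.lt_succ_self n)
    have hd : (Γ.start (Function.update (myopicProfile hu) i ρ) ω ν).draws =
      (Γ.start (myopicProfile hu) ω ν).draws := by cases ν <;> rfl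
    rw [stateAt_eq_run, stateAt_eq_run] at h2 h3 ⊢
    simp only [run, state] at h2 ⊢
    simp only [run_time, hd] at h2 h3 ⊢
    exact (move_myopic hu i ρ h3 _ _ _).resolve_left h2

/-! ### Optimality of the myopic profile -/

variable [Fintype N] [∀ i, Finite (S i)]

/-- The discounted loss until the next ring outweighs what may be gained later. -/
lemma integral_past_mul_nonpos {r lam M Δ : ℝ} (hl : 0 < lam) (hr : 0 < r) (hM₀ : 0 ≤ M)
    (hΔ : 0 < Δ) (hsmall : (Δ + 2 * M) * (Fintype.card (Clock N) * (lam / r)) < Δ) (n : ℕ)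
    {Φ : (ℕ → Clock N × ℝ) → ℝ} (hΦ : Measurable Φ) (hΦ0 : ∀ z, 0 ≤ Φ z) :
    ∫ W, Φ (pastRings n W) * (-Δ + (Δ + 2 * M) * Real.exp (-(r * (nextRing (advance^[n] W)).2)))
      ∂(waitsLaw N lam) ≤ 0 := by
  have hprob := isProbabilityMeasure_waitsLaw (N := N) hl
  obtain ⟨π, hπ, h⟩ := exists_map_pastRings_advance (N := N) hl n
  set g : (Clock N → ℕ → ℝ) → ℝ := fun W =>
    -Δ + (Δ + 2 * M) * Real.exp (-(r * (nextRing W).2)) with hg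
  have hgm : Measurable g := (measurable_exp_wait.const_mul _).const_add _
  have hmeas : Measurable fun p : (ℕ → Clock N × ℝ) × (Clock N → ℕ → ℝ) => Φ p.1 * g p.2 := by
    fun_prop
  have h1 : ∫ W, Φ (pastRings n W) * g (advance^[n] W) ∂(waitsLaw N lam) =
      -- By the renewal property the integral factors. The weight of the past is nonnegative, so
      -- only the sign of the mean of `g` matters and the law `π` of the past need not be known.
      ∫ p, Φ p.1 * g p.2 ∂(π.prod (waitsLaw N lam)) := by
    rw [← h, integral_map]
    · exact ((measurable_pastRings n).prodMk (measurable_advance.iterate n)).aemeasurable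
    · exact hmeas.aestronglyMeasurable
  change ∫ W, Φ (pastRings n W) * g (advance^[n] W) ∂(waitsLaw N lam) ≤ 0
  rw [h1, integral_prod_mul]
  refine mul_nonpos_of_nonneg_of_nonpos (integral_nonneg hΦ0) ?_
  have hei := integrable_exp_wait (N := N) hl hr
  rw [hg, integral_add (integrable_const _) (hei.const_mul _), integral_const,
    probReal_univ, one_smul, integral_const_mul]
  have := mul_le_mul_of_nonneg_left (integral_exp_wait_le (N := N) hl hr)
    (show 0 ≤ Δ + 2 * M by positivity)
  linarith

lemma measurable_stateAt (σ : Profile N S) (ν : Node N S) (n : ℕ) :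
    Measurable fun ω : Sample N => Γ.stateAt σ ν ω n := by
  obtain ⟨L, H, d, hH, hd, h⟩ := Γ.exists_measurableHistory_start σ ν
  simp only [stateAt, play_eq, h]
  exact measurable_state Γ (Γ.measurable_run σ hH ν.time
    (z := fun ω => rings ω.1) (by fun_prop) hd n).1

/-- The event that the outcomes differ for the first time after `n` rings. -/
def firstDeviation (Γ : RevisionGame N S) (σ σ' : Profile N S) (ν : Node N S) (n : ℕ) :
    Set (Sample N) :=
  {ω | (∀ k < n, Γ.stateAt σ' ν ω k = Γ.stateAt σ ν ω k) ∧ Γ.stateAt σ' ν ω n ≠ Γ.stateAt σ ν ω n}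

lemma measurableSet_firstDeviation (σ σ' : Profile N S) (ν : Node N S) (n : ℕ) :
    MeasurableSet (firstDeviation Γ σ σ' ν n) := by
  have h : ∀ k, MeasurableSet {ω | Γ.stateAt σ' ν ω k = Γ.stateAt σ ν ω k} := fun k =>
    measurableSet_eq_fun (Γ.measurable_stateAt σ' ν k) (Γ.measurable_stateAt σ ν k)
  have h' : {ω | ∀ k < n, Γ.stateAt σ' ν ω k = Γ.stateAt σ ν ω k} =
      ⋂ k, ⋂ (_ : k < n), {ω | Γ.stateAt σ' ν ω k = Γ.stateAt σ ν ω k} := by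
    ext; simp
  refine MeasurableSet.inter (?_ : MeasurableSet {ω | ∀ k < n, _ = _}) (h n).compl
  rw [h']
  exact MeasurableSet.iInter fun k => MeasurableSet.iInter fun _ => h k

/-- Given the draws, whether the outcomes differ for the first time after `n` rings depends only on
the first `n` rings. -/
lemma exists_firstDeviation_eq (σ σ' : Profile N S) (ν : Node N S) (n : ℕ)
    (d : ℕ → unitInterval × unitInterval) :
    ∃ A : Set (ℕ → Clock N × ℝ), MeasurableSet A ∧
      ∀ W, (W, d) ∈ firstDeviation Γ σ σ' ν n ↔ pastRings n W ∈ A := by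
  -- The history and the draws at the start do not depend on the waits, so zero waits stand in for
  -- them; the rings enter through `z` alone.
  set st : Profile N S → ℕ → (ℕ → Clock N × ℝ) → Outcome N S := fun τ k z =>
    Γ.state (Γ.run τ (Γ.start τ ((fun _ _ => 0 : Clock N → ℕ → ℝ), d) ν).history ν.time z
      (Γ.start τ ((fun _ _ => 0 : Clock N → ℕ → ℝ), d) ν).draws k).1 with hst
  have hstm : ∀ τ k, Measurable (st τ k) := fun τ k =>
    measurable_state Γ (Γ.measurable_run τ (measurableHistory_const _) ν.time measurable_id
      measurable_const k).1
  have heq : ∀ τ k W, k ≤ n → Γ.stateAt τ ν (W, d) k = st τ k (pastRings n W) := by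
    intro τ k W hk
    have h1 : (Γ.start τ (W, d) ν).history =
      (Γ.start τ ((fun _ _ => 0 : Clock N → ℕ → ℝ), d) ν).history := by cases ν <;> rfl
    have h2 : (Γ.start τ (W, d) ν).draws =
      (Γ.start τ ((fun _ _ => 0 : Clock N → ℕ → ℝ), d) ν).draws := by cases ν <;> rfl
    rw [stateAt_eq_run, h1, h2]
    simp only [st]
    rw [Γ.run_congr τ _ _ (z := rings W) (z' := pastRings n W)
      (fun l hl => (pastRings_of_lt (by omega) W).symm) fun _ _ => rfl]
  have h : ∀ k, MeasurableSet {z | st σ' k z = st σ k z} := fun k =>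
    measurableSet_eq_fun (hstm σ' k) (hstm σ k)
  have h' : {z | ∀ k < n, st σ' k z = st σ k z} =
      ⋂ k, ⋂ (_ : k < n), {z | st σ' k z = st σ k z} := by
    ext; simp
  refine ⟨{z | ∀ k < n, st σ' k z = st σ k z} ∩ {z | st σ' n z = st σ n z}ᶜ,
    MeasurableSet.inter ?_ (h n).compl, fun W => ?_⟩
  · rw [h']
    exact MeasurableSet.iInter fun k => MeasurableSet.iInter fun _ => h k
  · simp only [firstDeviation, Set.mem_ofPred_eq, Set.mem_inter_iff, Set.mem_compl_iff]
    refine and_congr (forall₂_congr fun k hk => ?_) ?_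
    · rw [heq σ' k W hk.le, heq σ k W hk.le]
    · rw [heq σ' n W le_rfl, heq σ n W le_rfl]

/-- The gain from a deviation is split by the number of rings after which the outcome first changes.
Each piece is at most a discounted loss of `Δ` until the next ring plus a later compensation; its
expectation is nonpositive because that next ring is independent of the change. No reduction to
one-shot deviations is needed. -/
theorem myopicProfile_isSPNE {M Δ : ℝ} (hM₀ : 0 ≤ M) (hΔ : 0 < Δ)
    (hM : ∀ i y, |Γ.payoff i y| ≤ M)
    (hgap : ∀ i y y', Γ.payoff i y < Γ.payoff i y' → Γ.payoff i y + Δ ≤ Γ.payoff i y')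
    (hsmall : (Δ + 2 * M) * (Fintype.card (Clock N) * (Γ.rate / Γ.discountRate)) < Δ) :
    Γ.IsSPNE (myopicProfile hu) := by
  intro ν hν i ρ
  have hprob := isProbabilityMeasure_sampleLaw (N := N) Γ.rate_pos
  have hprob' := isProbabilityMeasure_waitsLaw (N := N) Γ.rate_pos
  set σ := myopicProfile hu with hσ
  set σ' := Function.update σ i ρ with hσ'
  set r := Γ.discountRate with hr
  have hr0 : 0 < r := Γ.discountRate_pos
  set D : Sample N → ℝ := fun ω => Γ.pathValue σ' ν i ω - Γ.pathValue σ ν i ω with hD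
  have hDi : Integrable D (sampleLaw N Γ.rate) :=
    (Γ.integrable_pathValue (hM i) σ' ν _).sub (Γ.integrable_pathValue (hM i) σ ν _)
  suffices h : ∫ ω, D ω ∂(sampleLaw N Γ.rate) ≤ 0 by
    rw [hD, integral_sub (Γ.integrable_pathValue (hM i) σ' ν _)
      (Γ.integrable_pathValue (hM i) σ ν _)] at h
    exact sub_nonpos.1 h
  set A := firstDeviation Γ σ σ' ν with hA
  have hAm : ∀ n, MeasurableSet (A n) := measurableSet_firstDeviation σ σ' ν
  have hAd : Pairwise (Function.onFun Disjoint A) := by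
    intro m n hmn
    refine Set.disjoint_left.2 fun ω h1 h2 => ?_
    rcases lt_or_gt_of_ne hmn with h | h
    · exact h1.2 (h2.1 m h)
    · exact h2.2 (h1.1 n h)
  -- Without a first change the outcomes never differ, so deviations that leave no trace in the
  -- outcome contribute nothing.
  have hD0 : ∀ ω, ω ∉ ⋃ n, A n → D ω = 0 := by
    intro ω hω
    rw [Set.mem_iUnion, not_exists] at hω
    have : ∀ n, Γ.stateAt σ' ν ω n = Γ.stateAt σ ν ω n := fun n => by
      induction n using Nat.strong_induction_on with
      | _ n ih =>
        by_contra hn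
        exact hω n ⟨ih, hn⟩
    exact sub_eq_zero.2 (Γ.pathValue_congr this i)
  rw [← setIntegral_eq_integral_of_forall_compl_eq_zero hD0,
    integral_iUnion hAm hAd hDi.integrableOn]
  refine tsum_nonpos fun n => ?_
  set F : (Clock N → ℕ → ℝ) → ℝ := fun W => Real.exp (-(r * ringTime W n)) / r *
    (-Δ + (Δ + 2 * M) * Real.exp (-(r * (nextRing (advance^[n] W)).2))) with hF
  have hTm : Measurable fun W : Clock N → ℕ → ℝ => ringTime W n :=
    Finset.measurable_fun_sum _ fun k _ =>
      (measurable_nextRing.comp (measurable_advance.iterate k)).snd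
  have hFm : Measurable F := by
    have h1 : Measurable fun W : Clock N → ℕ → ℝ =>
        Real.exp (-(r * (nextRing (advance^[n] W)).2)) :=
      measurable_exp_wait.comp (measurable_advance.iterate n)
    have h2 : Measurable fun W : Clock N → ℕ → ℝ => Real.exp (-(r * ringTime W n)) :=
      Real.measurable_exp.comp (hTm.const_mul r).neg
    exact (h2.div_const r).mul ((h1.const_mul _).const_add _)
  have hpos := ae_iterate_advance_pos (N := N) Γ.rate_pos
  have hFi : Integrable F (waitsLaw N Γ.rate) := by
    refine Integrable.mono' (integrable_const (1 / r * (Δ + (Δ + 2 * M) * 1)))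
      hFm.aestronglyMeasurable ?_
    filter_upwards [hpos] with W hW
    have h1 : 0 ≤ ringTime W n := by
      rw [← ringTime_zero W]; exact (ringTime_strictMono hW).monotone (Nat.zero_le n)
    have h2 : 0 < (nextRing (advance^[n] W)).2 := hW n _ 0
    have h3 : Real.exp (-(r * ringTime W n)) ≤ 1 := Real.exp_le_one_iff.2 (by nlinarith)
    have h4 : Real.exp (-(r * (nextRing (advance^[n] W)).2)) ≤ 1 :=
      Real.exp_le_one_iff.2 (by nlinarith)
    rw [hF, norm_mul, norm_div, Real.norm_of_nonneg (Real.exp_pos _).le, Real.norm_of_nonneg hr0.le]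
    refine mul_le_mul (by gcongr) ((norm_add_le _ _).trans ?_) (norm_nonneg _) (by positivity)
    rw [norm_neg, norm_mul, Real.norm_of_nonneg hΔ.le, Real.norm_of_nonneg (Real.exp_pos _).le,
      Real.norm_of_nonneg (by positivity)]
    gcongr
  have hFi' : Integrable (fun ω : Sample N => F ω.1) (sampleLaw N Γ.rate) := by
    rw [sampleLaw_eq]; exact hFi.comp_fst _
  calc ∫ ω in A n, D ω ∂(sampleLaw N Γ.rate)
      ≤ ∫ ω in A n, F ω.1 ∂(sampleLaw N Γ.rate) := by
        refine setIntegral_mono_on_ae hDi.integrableOn hFi'.integrableOn (hAm n) ?_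
        filter_upwards [ae_sampleLaw_fst Γ.rate_pos hpos] with ω hω hωA
        exact Γ.pathValue_sub_le (hM i) hω hωA.1
          (hgap _ _ _ (payoff_lt_of_first_deviation hu i ρ hν hωA.1 hωA.2))
    _ = ∫ ω, (A n).indicator (fun ω => F ω.1) ω ∂(sampleLaw N Γ.rate) :=
        (integral_indicator (hAm n)).symm
    -- The waits are integrated first: with the draws fixed, the event `A n` is determined by the
    -- first `n` rings.
    _ = ∫ d, ∫ W, (A n).indicator (fun ω => F ω.1) (W, d) ∂(waitsLaw N Γ.rate) ∂drawsLaw := by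
        have := hFi'.indicator (hAm n)
        rw [sampleLaw_eq] at this ⊢
        exact integral_prod_symm _ this
    _ ≤ 0 := by
        refine integral_nonpos fun d => ?_
        obtain ⟨A', hA'm, hA'⟩ := exists_firstDeviation_eq (Γ := Γ) σ σ' ν n d
        have h := integral_past_mul_nonpos (N := N) (n := n) Γ.rate_pos hr0 hM₀ hΔ hsmall
          (Φ := A'.indicator fun z => Real.exp (-(r * ∑ k ∈ Finset.range n, (z k).2)) / r)
          (Measurable.indicator ?_ hA'm)
          (fun z => Set.indicator_nonneg (fun _ _ => by positivity) z)
        · refine le_trans (le_of_eq (integral_congr_ae (Filter.Eventually.of_forall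
            fun W => ?_))) h
          have hsum : ∑ k ∈ Finset.range n, (pastRings n W k).2 = ringTime W n :=
            Finset.sum_congr rfl fun k hk => by rw [pastRings_of_lt (Finset.mem_range.1 hk)]
          by_cases hW : (W, d) ∈ A n
          · have hW' := (hA' W).1 hW
            simp only [Set.indicator_of_mem hW, Set.indicator_of_mem hW', hsum, hF]
          · have hW' : pastRings n W ∉ A' := fun h => hW ((hA' W).2 h)
            simp only [Set.indicator_of_notMem hW, Set.indicator_of_notMem hW', zero_mul]
        · exact (Real.measurable_exp.comp ((Finset.measurable_fun_sum _ fun k _ =>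
            (measurable_pi_apply k).snd).const_mul r).neg).div_const r

omit [Fintype N] [∀ i, Finite (S i)] in
/-- The myopic profile never leaves a pairwise stable outcome. -/
lemma onPath_myopicProfile (hx : PairwiseStable Γ.payoff Γ.initial) (ω : Sample N) (t : ℝ) :
    Γ.onPath (myopicProfile hu) ω t = Γ.initial := by
  have hmove : ∀ h, Γ.state h = Γ.initial → ∀ t c r,
      (Γ.move (myopicProfile hu) h t c r).apply Γ.initial = Γ.initial := by
    intro h hh t c r
    obtain ⟨hx1, hx2, hx3⟩ := hx
    rcases c with i | ⟨⟨i, j⟩, hij⟩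
    · simp only [move, myopicProfile, Move.apply, hh]
      have hself : Γ.initial.setAction i (Γ.initial.2 i) = Γ.initial := by
        simp [Outcome.setAction]
      by_cases hb : Γ.initial.2 i = hu.bestAction i Γ.initial
      · rw [← hb, hself]
      · have := hu.lt_bestAction i Γ.initial hb
        rw [hself] at this
        exact absurd (hx1 i _) (not_le.2 this)
    · have hij : i ≠ j := hij
      by_cases hadj : (Γ.state h).1.Adj i j
      · rw [move_of_adj _ hij hadj]
        simp only [myopic_link_of_adj hu hadj, hh]
        rw [if_neg (hx2 i j (hh ▸ hadj))]
        rfl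
      · rw [move_of_not_adj _ hij hadj]
        simp only [myopic_link_of_not_adj hu hadj, hh]
        split_ifs with h1
        -- A proposal that benefits `i` alone may well be made, but then it is rejected: acceptance
        -- would require a strict gain for `j` as well, against pairwise stability.
        · simp only [answer_apply, myopic_respond, hh]
          rw [if_neg]
          exact fun h2 => hx3 i j hij (hh ▸ hadj) ⟨h1.le, h2.le, Or.inl h1⟩
        · rfl
  have hst : ∀ n, Γ.stateAt (myopicProfile hu) (.waiting [] 0) ω n = Γ.initial := by
    intro n
    induction n with
    | zero => rfl
    | succ n ih =>
      rw [stateAt_waiting] at ih ⊢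
      rw [run, state, ih]
      exact hmove _ ih _ _ _
  rcases Γ.outcomeAt_cases (myopicProfile hu) (Γ.start (myopicProfile hu) ω (.waiting [] 0)) t with
    ⟨n, h1, h2⟩ | h1
  · exact (Γ.outcomeAt_of_mem _ _ h1 h2).trans (hst n)
  · exact Γ.outcomeAt_of_forall_le _ _ h1

end RevisionGame

end
-- The bound on the rate and the conclusion
theorem proposition5 {N : Type*} [Fintype N] [DecidableEq N] [Nonempty N]
    {S : N → Type*} [∀ i, Finite (S i)]
    (u : N → Outcome N S → ℝ) (hu : GenericPayoffs u)
    (δ : ℝ) (hδ₀ : 0 < δ) (hδ₁ : δ < 1) :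
    ∃ lam₀ : ℝ, 0 < lam₀ ∧ ∀ (lam : ℝ) (hlam : 0 < lam), lam < lam₀ →
      -- an outcome that is played forever after a stopping time is pairwise stable
      (∀ (x₀ x : Outcome N S) (σ : Profile N S),
        (RevisionGame.mk u δ hδ₀ hδ₁ lam hlam x₀).IsSPNE σ →
        (∃ (ℱ : Filtration NNReal (inferInstance : MeasurableSpace (Sample N)))
            (τ : Sample N → WithTop NNReal),
          IsStoppingTime ℱ τ ∧
          (∀ᵐ ω ∂(sampleLaw N lam), τ ω < ⊤) ∧
          (∀ᵐ ω ∂(sampleLaw N lam), ∀ t : NNReal, τ ω ≤ t →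
            (RevisionGame.mk u δ hδ₀ hδ₁ lam hlam x₀).onPath σ ω t = x)) →
        PairwiseStable u x) ∧
      -- a pairwise stable outcome is sustained by an equilibrium that starts from it
      (∀ x : Outcome N S, PairwiseStable u x →
        ∃ σ : Profile N S, (∀ i, (σ i).IsPure) ∧
          (RevisionGame.mk u δ hδ₀ hδ₁ lam hlam x).IsSPNE σ ∧
          (∀ᵐ ω ∂(sampleLaw N lam), ∀ t : NNReal,
            (RevisionGame.mk u δ hδ₀ hδ₁ lam hlam x).onPath σ ω t = x)) := by
  obtain ⟨Δ, hΔ, hgap⟩ := exists_payoff_gap u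
  obtain ⟨M, hM₀, hM⟩ := exists_payoff_bound u
  have hr : 0 < -Real.log δ := neg_pos.2 (Real.log_neg hδ₀ hδ₁)
  have hc : 0 < (Δ + 2 * M) * (Fintype.card (Clock N) + 1 : ℝ) := by positivity
  -- Obtained by solving the smallness condition for the rate. The `+ 1` makes the denominator
  -- positive without a lower bound on the number of clocks.
  refine ⟨Δ * -Real.log δ / ((Δ + 2 * M) * (Fintype.card (Clock N) + 1)), by positivity,
    fun lam hlam hlt => ?_⟩
  have hsmall : (Δ + 2 * M) * (Fintype.card (Clock N) * (lam / -Real.log δ)) < Δ := by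
    rw [lt_div_iff₀ hc] at hlt
    rw [← mul_div_assoc, ← mul_div_assoc, div_lt_iff₀ hr]
    have h1 : 0 < (Δ + 2 * M) * lam := by positivity
    linarith [mul_comm lam ((Δ + 2 * M) * (Fintype.card (Clock N) + 1 : ℝ))]
  refine ⟨fun x₀ x σ hσ h => ?_, fun x hx => ?_⟩
  · obtain ⟨ℱ, τ, -, hτ, hx⟩ := h
    refine RevisionGame.pairwiseStable_of_absorbing hσ hM₀ hΔ hM hgap hsmall hu ?_
    filter_upwards [hτ, hx] with ω h1 h2
    obtain ⟨s, hs⟩ := WithTop.ne_top_iff_exists.1 h1.ne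
    refine ⟨s, fun t hst ht => h2 ⟨t, ht⟩ ?_⟩
    rw [← hs]
    exact WithTop.coe_le_coe.2 hst
  · exact ⟨RevisionGame.myopicProfile (Γ := RevisionGame.mk u δ hδ₀ hδ₁ lam hlam x) hu,
      RevisionGame.myopicProfile_isPure _,
      RevisionGame.myopicProfile_isSPNE _ hM₀ hΔ hM hgap hsmall,
      Filter.Eventually.of_forall fun ω t => RevisionGame.onPath_myopicProfile _ hx ω t⟩
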